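/- Let $\mathbb{H}^2$ be the hyperbolic plane with metric $d$, $\partial_\infty\mathbb{H}^2$ its boundary at infinity, $\overline{\mathbb{H}^2}=\mathbb{H}^2\cup\partial_\infty\mathbb{H}^2$, and let $G_0=\mathrm{PSL}_2(\mathbb{R})$ be its group of orientation-preserving isometries, which (with its usual topology) is also $\mathrm{AdS}^3$. The closure of a geodesic line $\ell$ in $\overline{\mathbb{H}^2}$ is denoted $\overline{\ell}$. A fixed point in $\overline{\mathbb{H}^2}$ of $h\in G_0$ is called nonattracting unless $h$ is hyperbolic and the point is its attracting fixed point. The right AdS crooked plane $\mathsf{C}^*(\ell)\subset G_0$ is the set of all $h\in G_0$ having a nonattracting fixed point in $\overline{\ell}$. A transverse orientation of $\ell$ is a choice of one of the two connected components of $\overline{\mathbb{H}^2}\smallsetminus\overline{\ell}$, called the positive side of $\overline\ell$; given one, $\mathsf{H}_+^*(\ell)\subset G_0$ is the set of nontrivial elements with a nonattracting fixed point on the positive side of $\overline{\ell}$, and $\overline{\mathsf{H}_+^*(\ell)}$ is its closure in $G_0$. Two transversely oriented lines are oriented away from each other if their positive sides are disjoint. For $\xi\neq\xi'$ in $\partial_\infty\mathbb{H}^2$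 and $g,g'\in G_0$, the expression $d(g\cdot\xi,g'\cdot\xi')-d(\xi,\xi')$ denotes the limit in $[-\infty,+\infty]$ of $d(g\cdot x,g'\cdot x')-d(x,x')$ as $(x,x')\in\mathbb{H}^2\times\mathbb{H}^2$ tends to $(\xi,\xi')$. **Theorem 3.2.** Let $\ell,\ell'$ be geodesic lines of $\mathbb{H}^2$. For $g,g'\in G_0$, the following conditions are equivalent: 1. the right AdS crooked planes $g\,\mathsf{C}^*(\ell)$ and $g'\,\mathsf{C}^*(\ell')$ are disjoint; 2. there exists $K>0$ such that $d(g\cdot x,g'\cdot x')-d(x,x')\leq -K$ for all $x\in\ell$ and $x'\in\ell'$; 3. for any endpoints $\xi$ of $\ell$ and $\xi'$ of $\ell'$ in $\partial_\infty\mathbb{H}^2$, we have $\xi\neq\xi'$, and $d(g\cdot\xi,g'\cdot\xi')-d(\xi,\xi')$ exists in $[-\infty,+\infty]$ and is $<0$. If these conditions hold, then $\ell$ and $\ell'$ have disjoint closures in $\overline{\mathbb{H}^2}$. Moreover, for any transverse orientations of $\ell$ and $\ell'$, the closed right AdS crooked half-spaces $g\,\overline{\mathsf{H}_+^*(\ell)}$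 and $g'\,\overline{\mathsf{H}_+^*(\ell')}$ are disjoint if and only if (1), (2), (3) hold and $\ell$ and $\ell'$ are transversely oriented away from each other. -/

import Mathlib

open Set Filter Topology UpperHalfPlane
open scoped MatrixGroups Pointwise

namespace AdSCrooked

/-! ### The group `G₀ = PSL₂(ℝ)`, the hyperbolic plane and its compactification

The hyperbolic plane is Mathlib's upper half-plane `ℍ` with its hyperbolic metric. Its
compactification by the circle at infinity is the closed upper half-plane of the Riemann sphere
`OnePoint ℂ`, on which `PSL₂(ℝ)` acts by Möbius transformations. -/

/-- `G₀ = PSL₂(ℝ)`; with its quotient topology it is also the anti-de Sitter space `AdS³`. -/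
abbrev G₀ : Type := PSL(2, ℝ)

/-- The isometric action of `PSL₂(ℝ)` on `ℍ` by Möbius transformations. -/
noncomputable instance actionPlane : MulAction G₀ ℍ :=
  MulAction.compHom ℍ (Matrix.ProjectiveSpecialLinearGroup.toPGL (n := Fin 2) (R := ℝ))

/-- The action of `SL₂(ℝ)` on the Riemann sphere by Möbius transformations. -/
noncomputable def slSphereHom : SL(2, ℝ) →* Equiv.Perm (OnePoint ℂ) :=
  (MulAction.toPermHom (GL (Fin 2) ℂ) (OnePoint ℂ)).comp
    (Matrix.SpecialLinearGroup.mapGL ℂ)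

/-- The centre `{±1}` of `SL₂(ℝ)` acts trivially on the Riemann sphere. -/
lemma center_le_ker : Subgroup.center SL(2, ℝ) ≤ slSphereHom.ker := by
  intro A hA
  obtain ⟨r, -, hr⟩ := Matrix.SpecialLinearGroup.mem_center_iff.mp hA
  have h00 : A 0 0 = r := by simp [← hr]
  have h01 : A 0 1 = 0 := by simp [← hr]
  have h10 : A 1 0 = 0 := by simp [← hr]
  have h11 : A 1 1 = r := by simp [← hr]
  have hdet := A.2
  rw [Matrix.det_fin_two] at hdet
  have hr0 : (r : ℂ) ≠ 0 := by
    intro h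
    have : r = 0 := by exact_mod_cast h
    simp_all
  rw [MonoidHom.mem_ker]
  ext1 z
  change (Matrix.SpecialLinearGroup.mapGL ℂ A) • z = z
  cases z with
  | infty => simp [OnePoint.smul_infty_eq_ite, h10]
  | coe z => simp [OnePoint.smul_some_eq_ite, h00, h01, h10, h11, hr0]

/-- The action of `PSL₂(ℝ)` on the Riemann sphere by Möbius transformations. -/
noncomputable instance actionSphere : MulAction G₀ (OnePoint ℂ) :=
  MulAction.compHom (OnePoint ℂ) (QuotientGroup.lift _ slSphereHom center_le_ker)

/-- The inclusion of `ℍ` in the Riemann sphere. -/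
def toSphere (z : ℍ) : OnePoint ℂ := ((z : ℂ) : OnePoint ℂ)

/-- The compactification `ℍ ∪ ∂_∞ ℍ`: the closed upper half-plane of the Riemann sphere,
with the subspace topology. -/
def closedPlane : Set (OnePoint ℂ) := closure (range toSphere)

/-- The boundary at infinity `∂_∞ ℍ` (that is, `ℝ ∪ {∞}`). -/
def idealBoundary : Set (OnePoint ℂ) := closedPlane \ range toSphere

/-! ### Geodesic lines and transverse orientations -/

/-- A geodesic line: the image of an isometric embedding of `ℝ`. -/
def IsGeodesicLine (l : Set ℍ) : Prop := ∃ γ : ℝ → ℍ, Isometry γ ∧ range γ = l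

/-- The closure of a subset of `ℍ` in `ℍ ∪ ∂_∞ ℍ`. -/
def clo (l : Set ℍ) : Set (OnePoint ℂ) := closure (toSphere '' l)

/-- The endpoints at infinity of a geodesic line. -/
def endpoints (l : Set ℍ) : Set (OnePoint ℂ) := clo l ∩ idealBoundary

/-- `S` is one of the two sides of the closure of `l` in `ℍ ∪ ∂_∞ ℍ`, i.e. a connected component
of its complement there. A transverse orientation of `l` is the choice of such a
side, called the positive side. -/
def IsSide (l : Set ℍ) (S : Set (OnePoint ℂ)) : Prop :=
  ∃ p ∈ closedPlane \ clo l, S = connectedComponentIn (closedPlane \ clo l) p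

/-! ### Right crooked planes and half-spaces -/

/-- Hyperbolic elements of `PSL₂(ℝ)`: those represented by a matrix with two distinct real
eigenvalues. -/
def IsHyperbolic (h : G₀) : Prop := ∃ A : SL(2, ℝ), (A : G₀) = h ∧ A.1.IsHyperbolic

/-- `p` is the attracting fixed point of the hyperbolic element `h`. (Fixed points of
elliptic or parabolic elements and of the identity are neither attracting nor repelling.) -/
def IsAttracting (h : G₀) (p : OnePoint ℂ) : Prop :=
  IsHyperbolic h ∧ ∀ z : ℍ, Tendsto (fun n : ℕ => toSphere (h ^ n • z)) atTop (𝓝 p)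

/-- `p` is a nonattracting fixed point of `h`. -/
def IsNonattractingFixedPoint (h : G₀) (p : OnePoint ℂ) : Prop :=
  h • p = p ∧ ¬ IsAttracting h p

/-- The right crooked plane `C*(l)` centered at the identity: the set of elements
with a nonattracting fixed point in the closure of `l`. -/
def rightCrookedPlane (l : Set ℍ) : Set G₀ :=
  {h | ∃ p ∈ clo l, IsNonattractingFixedPoint h p}

/-- The open right crooked half-space `H₊*(l)`, where `S` is the positive side of `l`: the set of
nontrivial elements with a nonattracting fixed point in `S`. -/
def rightHalfSpace (S : Set (OnePoint ℂ)) : Set G₀ :=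
  {h | h ≠ 1 ∧ ∃ p ∈ S, IsNonattractingFixedPoint h p}

/-! ### The three conditions -/

/-- The right crooked planes `g C*(l)` and `g' C*(l')` are disjoint. -/
def CrookedPlanesDisjoint (g g' : G₀) (l l' : Set ℍ) : Prop :=
  Disjoint (g • rightCrookedPlane l) (g' • rightCrookedPlane l')

/-- `d(g x, g' x') - d(x, x')` is bounded above by a negative constant on `l × l'`. -/
def UniformlyCloser (g g' : G₀) (l l' : Set ℍ) : Prop :=
  ∃ K : ℝ, 0 < K ∧ ∀ x ∈ l, ∀ x' ∈ l', dist (g • x) (g' • x') - dist x x' ≤ -K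

/-- `L`, in `ℝ ∪ {±∞}`, is the value at `(ξ, ξ')` of the continuous extension to
ideal points of the function `(x, x') ↦ d(g x, g' x') - d(x, x')` on `ℍ × ℍ`. -/
def HasExtendedDifference (g g' : G₀) (ξ ξ' : OnePoint ℂ) (L : EReal) : Prop :=
  Tendsto (fun q : ℍ × ℍ => ((dist (g • q.1) (g' • q.2) - dist q.1 q.2 : ℝ) : EReal))
    (comap toSphere (𝓝 ξ) ×ˢ comap toSphere (𝓝 ξ')) (𝓝 L)

/-- `l` and `l'` share no endpoint, and the extended difference is negative at all pairs of
endpoints. -/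
def CloserAtEndpoints (g g' : G₀) (l l' : Set ℍ) : Prop :=
  ∀ ξ ∈ endpoints l, ∀ ξ' ∈ endpoints l', ξ ≠ ξ' ∧
    ∃ L : EReal, HasExtendedDifference g g' ξ ξ' L ∧ L < 0

end AdSCrooked

open AdSCrooked

namespace AdSCrooked

/-! ### Symmetric bilinear forms on `ℝ²` -/

/-! Everything is transported to the cone of nonzero positive semidefinite symmetric matrices, on
which `SL(2, ℝ)` acts by `X ↦ g X gᵀ`. Matrices of determinant one form the hyperboloid model
(`pt`), with `cosh d = bil / 2`. Rays of the cone, normalised by trace one (`sig`), form the Klein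
model of the closed plane, whose ideal points are the rays of the rank-one matrices `sq v`. In these
terms a nonattracting fixed point of `H` is an eigenray of eigenvalue at most `1`
(`isNonattractingFixedPoint_iff`). If the columns `u, w` of `M` span the endpoints of a line, the
closed line consists of the rays `A • sq u + C • sq w` with `A, C ≥ 0`, and the sign of `coord M`
tells its two sides apart.

Each of the three conditions is equivalent to `PairingsDecrease`: for each of the four pairs of
endpoints `v, v'` one has `det2 (G v) (G' v') ^ 2 < det2 v v' ^ 2`. Since `bil (sq v) (sq v') = det2
v v' ^ 2`, bilinearity then makes `bil` decrease strictly for all pairs of points of the two closed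
lines (`PairingsDecrease.bil_lt`).

For the crooked planes, a common element `γ` has eigenrays with `γ X = μ G X` and `γ X' = μ' G' X'`,
where `μ, μ' ≤ 1`. Invariance of `bil` gives `bil X X' ≤ bil (G X) (G' X')`, which contradicts
strict decrease. Conversely, if a nonzero pairing fails to decrease, some `γ` sends `v` to `G v` and
`v'` to a multiple of `G' v'` of factor at most one in absolute value. A shared endpoint also yields
a common element, possibly with its second fixed point elsewhere on the second line
(`exists_common_of_det2_eq_zero`).

For uniform contraction, a common ratio `c < 1` of the pairings bounds the ratio of hyperbolic
cosines, and letting the points run to the endpoints recovers the pairings. For the endpoint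
condition, the extended difference is the logarithm of the ratio of the two `bil` values
(`hasExtendedDifference`).

For half-spaces, the closure replaces `0 < coord` by `0 ≤ coord`. Once the pairings decrease, the
positive sides are disjoint exactly when the four pairings have the same sign (`SameSign`). In that
case the cross terms of `bil` decrease too, so the argument for crooked planes extends. Otherwise
the positive ideal arcs meet, and the shared-endpoint construction gives a common element of the
half-spaces. -/

/-- The symmetric matrix with rows `(A, B)` and `(B, C)`, recorded as `(A, B, C)`. -/
abbrev Form : Type := ℝ × ℝ × ℝ

/-- The action `X ↦ g X gᵀ` of `SL₂(ℝ)` on symmetric matrices. -/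
def act (g : SL(2, ℝ)) (X : Form) : Form :=
  (g 0 0 ^ 2 * X.1 + 2 * (g 0 0 * g 0 1) * X.2.1 + g 0 1 ^ 2 * X.2.2,
    g 0 0 * g 1 0 * X.1 + (g 0 0 * g 1 1 + g 0 1 * g 1 0) * X.2.1 + g 0 1 * g 1 1 * X.2.2,
    g 1 0 ^ 2 * X.1 + 2 * (g 1 0 * g 1 1) * X.2.1 + g 1 1 ^ 2 * X.2.2)

/-- The determinant of a symmetric matrix. -/
def qdet (X : Form) : ℝ := X.1 * X.2.2 - X.2.1 ^ 2

/-- The polarization of `2 * qdet`. -/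
def bil (X Y : Form) : ℝ := X.1 * Y.2.2 + X.2.2 * Y.1 - 2 * (X.2.1 * Y.2.1)

/-- The determinant of two vectors of the plane. -/
def det2 (v w : ℝ × ℝ) : ℝ := v.1 * w.2 - v.2 * w.1

/-- The linear action of `SL₂(ℝ)` on the plane. -/
def mulv (g : SL(2, ℝ)) (v : ℝ × ℝ) : ℝ × ℝ :=
  (g 0 0 * v.1 + g 0 1 * v.2, g 1 0 * v.1 + g 1 1 * v.2)

/-- The columns of a matrix. -/
def col (g : SL(2, ℝ)) (i : Fin 2) : ℝ × ℝ := (g 0 i, g 1 i)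

/-- The symmetric matrix `v vᵀ`. -/
def sq (v : ℝ × ℝ) : Form := (v.1 ^ 2, v.1 * v.2, v.2 ^ 2)

/-- The cone of nonzero positive semidefinite matrices. -/
def InCone (X : Form) : Prop := 0 ≤ X.1 ∧ 0 ≤ X.2.2 ∧ 0 ≤ qdet X ∧ X ≠ 0

/-- `X` is an eigenvector of the action of `H` for an eigenvalue at most `1`. -/
def NonexpandingEigen (H : SL(2, ℝ)) (X : Form) : Prop := ∃ μ : ℝ, μ ≤ 1 ∧ act H X = μ • X

lemma det_eq (g : SL(2, ℝ)) : g 0 0 * g 1 1 - g 0 1 * g 1 0 = 1 := by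
  have := g.2
  rwa [Matrix.det_fin_two] at this

lemma mul_entry (g h : SL(2, ℝ)) (i j : Fin 2) :
    (g * h) i j = g i 0 * h 0 j + g i 1 * h 1 j := by
  simp [Matrix.mul_apply, Fin.sum_univ_two]

lemma inv_entries (g : SL(2, ℝ)) :
    g⁻¹ 0 0 = g 1 1 ∧ g⁻¹ 0 1 = -g 0 1 ∧ g⁻¹ 1 0 = -g 1 0 ∧ g⁻¹ 1 1 = g 0 0 := by
  simp [Matrix.SpecialLinearGroup.SL2_inv_expl]

lemma act_mul (g h : SL(2, ℝ)) (X : Form) : act (g * h) X = act g (act h X) := by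
  simp only [act, mul_entry]
  ext <;> simp only <;> ring

lemma act_one (X : Form) : act 1 X = X := by
  simp [act]

lemma act_neg (g : SL(2, ℝ)) (X : Form) : act (-g) X = act g X := by
  simp [act]

@[simp] lemma act_inv_act (g : SL(2, ℝ)) (X : Form) : act g⁻¹ (act g X) = X := by
  rw [← act_mul, inv_mul_cancel, act_one]

@[simp] lemma act_act_inv (g : SL(2, ℝ)) (X : Form) : act g (act g⁻¹ X) = X := by
  rw [← act_mul, mul_inv_cancel, act_one]

lemma act_add (g : SL(2, ℝ)) (X Y : Form) : act g (X + Y) = act g X + act g Y := by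
  simp only [act]
  ext <;> simp <;> ring

lemma act_smul (g : SL(2, ℝ)) (c : ℝ) (X : Form) : act g (c • X) = c • act g X := by
  simp only [act]
  ext <;> simp <;> ring

lemma act_zero (g : SL(2, ℝ)) : act g 0 = 0 := by
  simp [act]

lemma qdet_act (g : SL(2, ℝ)) (X : Form) : qdet (act g X) = qdet X := by
  have h := det_eq g
  have : qdet (act g X) = (g 0 0 * g 1 1 - g 0 1 * g 1 0) ^ 2 * qdet X := by
    simp only [qdet, act]; ring
  rw [this, h]; ring

lemma bil_act (g : SL(2, ℝ)) (X Y : Form) : bil (act g X) (act g Y) = bil X Y := by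
  have h := det_eq g
  have : bil (act g X) (act g Y) = (g 0 0 * g 1 1 - g 0 1 * g 1 0) ^ 2 * bil X Y := by
    simp only [bil, act]; ring
  rw [this, h]; ring

lemma bil_smul_left (c : ℝ) (X Y : Form) : bil (c • X) Y = c * bil X Y := by
  simp only [bil, Prod.smul_fst, Prod.smul_snd, smul_eq_mul]; ring

lemma bil_smul_right (c : ℝ) (X Y : Form) : bil X (c • Y) = c * bil X Y := by
  simp only [bil, Prod.smul_fst, Prod.smul_snd, smul_eq_mul]; ring

lemma bil_add_right (X Y Z : Form) : bil X (Y + Z) = bil X Y + bil X Z := by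
  simp only [bil, Prod.fst_add, Prod.snd_add]; ring

lemma bil_comm (X Y : Form) : bil X Y = bil Y X := by
  simp only [bil]; ring

lemma bil_self (X : Form) : bil X X = 2 * qdet X := by
  simp only [bil, qdet]; ring

lemma qdet_smul (c : ℝ) (X : Form) : qdet (c • X) = c ^ 2 * qdet X := by
  simp only [qdet, Prod.smul_fst, Prod.smul_snd, smul_eq_mul]; ring

lemma qdet_sq (v : ℝ × ℝ) : qdet (sq v) = 0 := by
  simp only [qdet, sq]; ring

lemma bil_sq (v w : ℝ × ℝ) : bil (sq v) (sq w) = det2 v w ^ 2 := by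
  simp only [bil, sq, det2]; ring

lemma act_sq (g : SL(2, ℝ)) (v : ℝ × ℝ) : act g (sq v) = sq (mulv g v) := by
  simp only [act, sq, mulv]
  ext <;> simp only <;> ring

lemma sq_smul (c : ℝ) (v : ℝ × ℝ) : sq (c • v) = c ^ 2 • sq v := by
  simp only [sq, Prod.smul_fst, Prod.smul_snd, smul_eq_mul]
  ext <;> simp <;> ring

lemma sq_eq_zero {v : ℝ × ℝ} (h : sq v = 0) : v = 0 := by
  simp only [sq, Prod.ext_iff] at h
  ext
  · simpa using h.1
  · simpa using h.2.2

lemma mulv_mul (g h : SL(2, ℝ)) (v : ℝ × ℝ) : mulv (g * h) v = mulv g (mulv h v) := by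
  simp only [mulv, mul_entry]
  ext <;> simp only <;> ring

@[simp] lemma mulv_inv_mulv (g : SL(2, ℝ)) (v : ℝ × ℝ) : mulv g⁻¹ (mulv g v) = v := by
  rw [← mulv_mul, inv_mul_cancel]; simp [mulv]

lemma mulv_smul (g : SL(2, ℝ)) (c : ℝ) (v : ℝ × ℝ) : mulv g (c • v) = c • mulv g v := by
  simp only [mulv, Prod.smul_fst, Prod.smul_snd, smul_eq_mul]
  ext <;> simp <;> ring

lemma col_mul (g h : SL(2, ℝ)) (i : Fin 2) : col (g * h) i = mulv g (col h i) := by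
  simp [col, mulv, mul_entry]

lemma det2_col (g : SL(2, ℝ)) : det2 (col g 0) (col g 1) = 1 := by
  have := det_eq g
  simp only [det2, col]; linarith

lemma exists_col {u w : ℝ × ℝ} (h : det2 u w = 1) : ∃ M : SL(2, ℝ), col M 0 = u ∧ col M 1 = w :=
  ⟨⟨!![u.1, w.1; u.2, w.2], by
    rw [Matrix.det_fin_two_of]; simp only [det2] at h; linarith⟩, by simp [col], by simp [col]⟩

lemma mulv_e0 (M : SL(2, ℝ)) : mulv M (1, 0) = col M 0 := by simp [mulv, col]

lemma mulv_e1 (M : SL(2, ℝ)) : mulv M (0, 1) = col M 1 := by simp [mulv, col]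

lemma exists_mulv_e0 {v : ℝ × ℝ} (hv : v ≠ 0) : ∃ M : SL(2, ℝ), mulv M (1, 0) = v := by
  have hn : v.1 ^ 2 + v.2 ^ 2 ≠ 0 := by
    intro h
    apply hv
    ext
    · simp only [Prod.fst_zero]; nlinarith [sq_nonneg v.1, sq_nonneg v.2]
    · simp only [Prod.snd_zero]; nlinarith [sq_nonneg v.1, sq_nonneg v.2]
  obtain ⟨M, hM, -⟩ := exists_col (u := v)
    (w := (-v.2 / (v.1 ^ 2 + v.2 ^ 2), v.1 / (v.1 ^ 2 + v.2 ^ 2)))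
    (by simp only [det2]; field_simp; ring)
  exact ⟨M, by rw [mulv_e0, hM]⟩

lemma mulv_ne_zero (g : SL(2, ℝ)) {v : ℝ × ℝ} (hv : v ≠ 0) : mulv g v ≠ 0 := by
  intro h
  apply hv
  rw [← mulv_inv_mulv g v, h]
  simp [mulv]

lemma InCone.act {X : Form} (hX : InCone X) (g : SL(2, ℝ)) : InCone (act g X) := by
  obtain ⟨hA, hC, hd, h0⟩ := hX
  have key : ∀ a b : ℝ, 0 ≤ a ^ 2 * X.1 + 2 * (a * b) * X.2.1 + b ^ 2 * X.2.2 := by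
    intro a b
    simp only [qdet] at hd
    rcases hA.eq_or_lt with h | h
    · have hB : X.2.1 = 0 := by rw [← h] at hd; nlinarith [sq_nonneg X.2.1]
      rw [← h, hB]; nlinarith [mul_nonneg (sq_nonneg b) hC]
    -- Completing the square: this product is `(a A + b B)² + b² det X`.
    · have : 0 ≤ X.1 * (a ^ 2 * X.1 + 2 * (a * b) * X.2.1 + b ^ 2 * X.2.2) := by
        nlinarith [sq_nonneg (a * X.1 + b * X.2.1), mul_nonneg (sq_nonneg b) hd]
      exact nonneg_of_mul_nonneg_right this h
  refine ⟨key _ _, key _ _, by rwa [qdet_act], fun h => h0 ?_⟩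
  rw [← act_inv_act g X, h, act_zero]

lemma InCone.smul {X : Form} (hX : InCone X) {c : ℝ} (hc : 0 < c) : InCone (c • X) := by
  obtain ⟨hA, hC, hd, h0⟩ := hX
  refine ⟨mul_nonneg hc.le hA, mul_nonneg hc.le hC, ?_, smul_ne_zero hc.ne' h0⟩
  rw [qdet_smul]; positivity

lemma InCone.trace_pos {X : Form} (hX : InCone X) : 0 < X.1 + X.2.2 := by
  obtain ⟨hA, hC, hd, h0⟩ := hX
  refine lt_of_le_of_ne (add_nonneg hA hC) fun h => h0 ?_
  simp only [qdet] at hd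
  have h1 : X.1 = 0 := by linarith
  have h2 : X.2.2 = 0 := by linarith
  have h3 : X.2.1 = 0 := by rw [h1] at hd; nlinarith [sq_nonneg X.2.1]
  ext <;> simp [h1, h2, h3]

lemma inCone_sq {v : ℝ × ℝ} (hv : v ≠ 0) : InCone (sq v) :=
  ⟨sq_nonneg _, sq_nonneg _, (qdet_sq v).ge, fun h => hv (sq_eq_zero h)⟩

lemma exists_eq_sq {X : Form} (hA : 0 ≤ X.1) (hC : 0 ≤ X.2.2) (hd : qdet X = 0) :
    ∃ v, X = sq v := by
  simp only [qdet] at hd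
  have hB : X.2.1 ^ 2 = (√X.1 * √X.2.2) ^ 2 := by
    rw [mul_pow, Real.sq_sqrt hA, Real.sq_sqrt hC]; linarith
  rcases sq_eq_sq_iff_eq_or_eq_neg.mp hB with h | h
  · refine ⟨(√X.1, √X.2.2), ?_⟩
    ext <;> simp [sq, Real.sq_sqrt, *]
  · refine ⟨(√X.1, -√X.2.2), ?_⟩
    ext <;> simp [sq, Real.sq_sqrt, *]

lemma eq_or_eq_neg_of_sq_eq_sq {v w : ℝ × ℝ} (h : sq v = sq w) : v = w ∨ v = -w := by
  simp only [sq, Prod.mk.injEq] at h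
  obtain ⟨h1, h2, h3⟩ := h
  rcases sq_eq_sq_iff_eq_or_eq_neg.mp h1 with a | a <;>
    rcases sq_eq_sq_iff_eq_or_eq_neg.mp h3 with b | b
  · exact Or.inl (Prod.ext a b)
  · by_cases hw : w.1 = 0
    · exact Or.inr (Prod.ext (by simp [a, hw]) (by simp [b]))
    · have : w.2 = 0 := by
        rw [a, b] at h2
        have : w.1 * w.2 = 0 := by linarith
        simpa [hw] using this
      exact Or.inl (Prod.ext a (by simp [b, this]))
  · by_cases hw : w.1 = 0
    · exact Or.inl (Prod.ext (by simp [a, hw]) b)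
    · have : w.2 = 0 := by
        rw [a, b] at h2
        have : w.1 * w.2 = 0 := by linarith
        simpa [hw] using this
      exact Or.inr (Prod.ext (by simp [a]) (by simp [b, this]))
  · exact Or.inr (Prod.ext (by simp [a]) (by simp [b]))

/-- The reverse Cauchy-Schwarz inequality. -/
lemma two_qdet_le_bil {X Y : Form} (hX : InCone X) (hY : InCone Y) (h : qdet X = qdet Y) :
    2 * qdet X ≤ bil X Y := by
  obtain ⟨hA, hC, hd, -⟩ := hX
  obtain ⟨hA', hC', hd', -⟩ := hY
  simp only [qdet, bil] at *
  have h1 : (X.1 * X.2.2 - X.2.1 ^ 2 + |X.2.1 * Y.2.1|) ^ 2 ≤ (X.1 * Y.2.2) * (X.2.2 * Y.1) := by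
    have e1 : (X.1 * Y.2.2) * (X.2.2 * Y.1) = (X.1 * X.2.2 - X.2.1 ^ 2 + X.2.1 ^ 2) *
        (X.1 * X.2.2 - X.2.1 ^ 2 + Y.2.1 ^ 2) := by
      linear_combination -(X.1 * X.2.2) * h
    rw [e1, abs_mul]
    have := mul_nonneg hd (sq_nonneg (|X.2.1| - |Y.2.1|))
    nlinarith [sq_abs X.2.1, sq_abs Y.2.1]
  have h2 : 2 * (X.1 * X.2.2 - X.2.1 ^ 2 + |X.2.1 * Y.2.1|) ≤ X.1 * Y.2.2 + X.2.2 * Y.1 := by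
    apply le_of_sq_le_sq _ (by positivity)
    nlinarith [sq_nonneg (X.1 * Y.2.2 - X.2.2 * Y.1)]
  linarith [le_abs_self (X.2.1 * Y.2.1)]

/-- Expansion of `bil` in the bases of columns of two matrices. -/
lemma bil_act_act (N N' : SL(2, ℝ)) (X X' : Form) :
    bil (act N X) (act N' X') =
      X.1 * X'.1 * det2 (col N 0) (col N' 0) ^ 2 + X.1 * X'.2.2 * det2 (col N 0) (col N' 1) ^ 2 +
      X.2.2 * X'.1 * det2 (col N 1) (col N' 0) ^ 2 +
      X.2.2 * X'.2.2 * det2 (col N 1) (col N' 1) ^ 2 +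
      2 * (X.1 * X'.2.1) * (det2 (col N 0) (col N' 0) * det2 (col N 0) (col N' 1)) +
      2 * (X.2.1 * X'.1) * (det2 (col N 0) (col N' 0) * det2 (col N 1) (col N' 0)) +
      2 * (X.2.1 * X'.2.2) * (det2 (col N 0) (col N' 1) * det2 (col N 1) (col N' 1)) +
      2 * (X.2.2 * X'.2.1) * (det2 (col N 1) (col N' 0) * det2 (col N 1) (col N' 1)) +
      2 * (X.2.1 * X'.2.1) * (det2 (col N 0) (col N' 0) * det2 (col N 1) (col N' 1) +
        det2 (col N 0) (col N' 1) * det2 (col N 1) (col N' 0)) := by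
  simp only [bil, act, det2, col]; ring

/-- The transverse coordinate in the basis of columns of `M`, in the basis of columns of `M'`. -/
lemma act_inv_mul_coord (M M' : SL(2, ℝ)) (X : Form) :
    (act M⁻¹ (act M' X)).2.1 =
      -(X.1 * (det2 (col M 0) (col M' 0) * det2 (col M 1) (col M' 0)) +
        X.2.1 * (det2 (col M 0) (col M' 0) * det2 (col M 1) (col M' 1) +
          det2 (col M 0) (col M' 1) * det2 (col M 1) (col M' 0)) +
        X.2.2 * (det2 (col M 0) (col M' 1) * det2 (col M 1) (col M' 1))) := by
  obtain ⟨h1, h2, h3, h4⟩ := inv_entries M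
  simp only [act, h1, h2, h3, h4, det2, col]; ring

lemma act_eq_of_coord_eq_zero (M : SL(2, ℝ)) {X : Form} (h : X.2.1 = 0) :
    act M X = X.1 • sq (col M 0) + X.2.2 • sq (col M 1) := by
  simp only [act, sq, col, h]
  ext <;> simp <;> ring

/-- The determinant of the pairing between two bases of determinant one. -/
lemma det_pairing (M M' : SL(2, ℝ)) :
    det2 (col M 0) (col M' 0) * det2 (col M 1) (col M' 1) -
      det2 (col M 0) (col M' 1) * det2 (col M 1) (col M' 0) = 1 := by
  have h := det_eq M
  have h' := det_eq M'
  have : det2 (col M 0) (col M' 0) * det2 (col M 1) (col M' 1) -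
      det2 (col M 0) (col M' 1) * det2 (col M 1) (col M' 0) =
      (M 0 0 * M 1 1 - M 0 1 * M 1 0) * (M' 0 0 * M' 1 1 - M' 0 1 * M' 1 0) := by
    simp only [det2, col]; ring
  rw [this, h, h', one_mul]

lemma exists_smul_of_det2_eq_zero {v w : ℝ × ℝ} (hv : v ≠ 0) (h : det2 v w = 0) :
    ∃ c : ℝ, w = c • v := by
  simp only [det2] at h
  by_cases h1 : v.1 = 0
  · have h2 : v.2 ≠ 0 := fun h2 => hv (Prod.ext h1 h2)
    refine ⟨w.2 / v.2, Prod.ext ?_ ?_⟩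
    · have : w.1 = 0 := by rw [h1] at h; simpa [h2] using h
      simp [h1, this]
    · simp [h2]
  · refine ⟨w.1 / v.1, Prod.ext ?_ ?_⟩
    · simp [h1]
    · simp only [Prod.smul_snd, smul_eq_mul]; field_simp; linarith

/-! ### Transitivity properties -/

lemma exists_mulv_pair {v v' x x' : ℝ × ℝ} (h : det2 v v' = det2 x x') (h0 : det2 v v' ≠ 0) :
    ∃ γ : SL(2, ℝ), mulv γ v = x ∧ mulv γ v' = x' := by
  have aux : ∀ {v v' : ℝ × ℝ}, det2 v v' ≠ 0 → ∃ P : SL(2, ℝ), mulv P (1, 0) = v ∧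
      mulv P (0, det2 v v') = v' := by
    intro v v' h0
    obtain ⟨P, h1, h2⟩ := exists_col (u := v) (w := (det2 v v')⁻¹ • v')
      (by simp only [det2, Prod.smul_fst, Prod.smul_snd, smul_eq_mul] at *; field_simp)
    refine ⟨P, by rw [mulv_e0, h1], ?_⟩
    have : ((0, det2 v v') : ℝ × ℝ) = det2 v v' • (0, 1) := by simp
    rw [this, mulv_smul, mulv_e1, h2, smul_smul, mul_inv_cancel₀ h0, one_smul]
  obtain ⟨P, hP, hP'⟩ := aux h0
  obtain ⟨Q, hQ, hQ'⟩ := aux (h ▸ h0)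
  refine ⟨Q * P⁻¹, ?_, ?_⟩
  · rw [mulv_mul, ← hP, mulv_inv_mulv, hQ]
  · rw [mulv_mul, ← hP', mulv_inv_mulv, h, hQ']

/-- The values `bil (sq v) X` and `qdet X` determine the pair `(v, X)` up to `SL(2, ℝ)` when the
first is nonzero: move `v` to `(1, 0)`, then make `X` diagonal with the unipotent matrices fixing
`(1, 0)`. -/
lemma exists_act_mixed {v x : ℝ × ℝ} {X Y : Form} (h : bil (sq v) X = bil (sq x) Y)
    (h0 : bil (sq v) X ≠ 0) (hd : qdet X = qdet Y) :
    ∃ γ : SL(2, ℝ), mulv γ v = x ∧ act γ X = Y := by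
  have aux : ∀ {v : ℝ × ℝ} {X : Form}, bil (sq v) X ≠ 0 → ∃ P : SL(2, ℝ), mulv P (1, 0) = v ∧
      act P (qdet X / bil (sq v) X, 0, bil (sq v) X) = X := by
    intro v X h0
    obtain ⟨P, hP⟩ := exists_mulv_e0 (v := v) (by rintro rfl; simp [sq, bil] at h0)
    have hC : bil (sq v) X = (act P⁻¹ X).2.2 := by
      rw [← hP, ← act_sq, ← bil_act P⁻¹, act_inv_act]; simp [bil, sq]
    rw [hC] at h0 ⊢
    rw [← qdet_act P⁻¹ X]
    set Z := act P⁻¹ X with hZ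
    let n : SL(2, ℝ) := ⟨!![1, Z.2.1 / Z.2.2; 0, 1], by rw [Matrix.det_fin_two_of]; ring⟩
    refine ⟨P * n, ?_, ?_⟩
    · rw [mulv_mul, ← hP]; simp [n, mulv]
    · rw [act_mul, ← act_act_inv P X, ← hZ]
      congr 1
      simp only [act, n, qdet]
      ext
      · simp; field_simp; ring
      · simp; field_simp
      · simp
  obtain ⟨P, hP, hP'⟩ := aux h0
  obtain ⟨Q, hQ, hQ'⟩ := aux (h ▸ h0)
  refine ⟨Q * P⁻¹, ?_, ?_⟩
  · rw [mulv_mul, ← hP, mulv_inv_mulv, hQ]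
  · rw [h, hd] at hP'
    rw [act_mul, ← hP', act_inv_act, hQ']

/-! ### Common elements of crooked planes -/

/-- Take `γ` agreeing with `G` on `v` and with a multiple of `G'` on `v'`. Preservation of area
forces the factor `e / f`, and the hypothesis says that its square is at most one. -/
lemma exists_common_of_le {v v' : ℝ × ℝ} {G G' : SL(2, ℝ)} (h0 : det2 v v' ≠ 0)
    (h : det2 v v' ^ 2 ≤ det2 (mulv G v) (mulv G' v') ^ 2) :
    ∃ γ : SL(2, ℝ), NonexpandingEigen (G⁻¹ * γ) (sq v) ∧ NonexpandingEigen (G'⁻¹ * γ) (sq v') := by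
  set e := det2 v v' with he
  set f := det2 (mulv G v) (mulv G' v') with hf
  have hf0 : f ≠ 0 := by
    intro hf0
    rw [hf0] at h
    have := sq_pos_of_ne_zero h0
    nlinarith
  obtain ⟨γ, h1, h2⟩ := exists_mulv_pair (v := v) (v' := v') (x := mulv G v)
    (x' := (e / f) • mulv G' v') (by
      have : det2 (mulv G v) ((e / f) • mulv G' v') = e / f * f := by
        rw [hf]; simp only [det2, Prod.smul_fst, Prod.smul_snd, smul_eq_mul]; ring
      rw [this, ← he]; field_simp) h0
  refine ⟨γ, ⟨1, le_rfl, ?_⟩, ⟨(e / f) ^ 2, ?_, ?_⟩⟩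
  · rw [act_sq, mulv_mul, h1, mulv_inv_mulv, one_smul]
  · rw [div_pow]
    exact div_le_one_of_le₀ h (sq_nonneg _)
  · rw [act_sq, mulv_mul, h2, mulv_smul, mulv_inv_mulv, sq_smul]

/-- The case of a shared ideal point, `v` and `v'` being proportional. The second eigenray is sought
on the closed line from `v'` to `v''`, whose points have the form `a • sq v' + b • sq v''`. -/
lemma exists_common_of_det2_eq_zero {v v' v'' : ℝ × ℝ} {G G' : SL(2, ℝ)} (hv : v ≠ 0)
    (hv' : v' ≠ 0) (h0 : det2 v v' = 0) (h1 : det2 v' v'' ≠ 0) :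
    ∃ (γ : SL(2, ℝ)) (a b : ℝ), 0 ≤ a ∧ 0 ≤ b ∧ (0 < a ∨ 0 < b) ∧
      NonexpandingEigen (G⁻¹ * γ) (sq v) ∧
      NonexpandingEigen (G'⁻¹ * γ) (a • sq v' + b • sq v'') := by
  set F := det2 (mulv G v) (mulv G' v') with hF
  obtain ⟨c, hc⟩ := exists_smul_of_det2_eq_zero hv h0
  have hc0 : c ≠ 0 := by rintro rfl; exact hv' (by simpa using hc)
  by_cases hF0 : F = 0
  · obtain ⟨d, hd⟩ := exists_smul_of_det2_eq_zero (mulv_ne_zero G hv) hF0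
    have hd0 : d ≠ 0 := by
      rintro rfl; exact mulv_ne_zero G' hv' (by simpa using hd)
    have hGv : mulv G v = d⁻¹ • mulv G' v' := by rw [hd, smul_smul, inv_mul_cancel₀ hd0, one_smul]
    -- Here `G` and `G'` also agree on the common ray. `G'⁻¹ * G` and `G⁻¹ * G'` scale it by inverse
    -- factors, so one of `γ = G`, `γ = G'` works.
    by_cases hle : (c / d) ^ 2 ≤ 1
    · refine ⟨G, 1, 0, zero_le_one, le_rfl, Or.inl one_pos, ⟨1, le_rfl, ?_⟩, ⟨(c / d) ^ 2, hle, ?_⟩⟩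
      · rw [inv_mul_cancel, act_one, one_smul]
      · have : mulv (G'⁻¹ * G) v' = (c / d) • v' := by
          rw [mulv_mul]; nth_rewrite 1 [hc]
          rw [mulv_smul, hGv, mulv_smul, mulv_smul, mulv_inv_mulv, smul_smul, div_eq_mul_inv]
        rw [one_smul, zero_smul, add_zero, act_sq, this, sq_smul]
    · refine ⟨G', 1, 0, zero_le_one, le_rfl, Or.inl one_pos, ⟨(d / c) ^ 2, ?_, ?_⟩, ⟨1, le_rfl, ?_⟩⟩
      · rw [← inv_div, inv_pow]
        exact inv_le_one_of_one_le₀ (not_le.mp hle).le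
      · have hvv : v = c⁻¹ • v' := by rw [hc, smul_smul, inv_mul_cancel₀ hc0, one_smul]
        have : mulv (G⁻¹ * G') v = (d / c) • v := by
          rw [mulv_mul]; nth_rewrite 1 [hvv]
          rw [mulv_smul, hd, mulv_smul, mulv_smul, mulv_inv_mulv, smul_smul, div_eq_inv_mul]
        rw [act_sq, this, sq_smul]
      · rw [inv_mul_cancel, act_one]; simp
  · have he0 : det2 v v'' ≠ 0 := by
      intro h
      apply h1
      rw [hc]
      simp only [det2, Prod.smul_fst, Prod.smul_snd, smul_eq_mul] at *
      linear_combination c * h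
    by_cases hle : det2 v v'' ^ 2 ≤ det2 (mulv G v) (mulv G' v'') ^ 2
    · obtain ⟨γ, h2, h3⟩ := exists_common_of_le he0 hle
      exact ⟨γ, 0, 1, le_rfl, zero_le_one, Or.inr one_pos, h2, by simpa using h3⟩
    · push Not at hle
      have hF2 : 0 < F ^ 2 := sq_pos_of_ne_zero hF0
      -- The weights `a` and `F ^ 2` are chosen so that `sq v` pairs with the combination exactly as
      -- `G v` pairs with its image under `G'`. Then `γ` can match `G` at `v` and `G'` at the
      -- combination, both with eigenvalue one.
      set a := det2 v v'' ^ 2 - det2 (mulv G v) (mulv G' v'') ^ 2 with ha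
      have hX : bil (sq v) (a • sq v' + F ^ 2 • sq v'') = F ^ 2 * det2 v v'' ^ 2 := by
        rw [bil_add_right, bil_smul_right, bil_smul_right, bil_sq, bil_sq, h0]; ring
      obtain ⟨γ, h2, h3⟩ := exists_act_mixed (v := v) (x := mulv G v)
        (X := a • sq v' + F ^ 2 • sq v'') (Y := act G' (a • sq v' + F ^ 2 • sq v'')) (by
          rw [hX, act_add, act_smul, act_smul, act_sq, act_sq, bil_add_right, bil_smul_right,
            bil_smul_right, bil_sq, bil_sq, ← hF, ha]; ring)
        (by rw [hX]; exact mul_ne_zero hF2.ne' (pow_ne_zero 2 he0)) (qdet_act _ _).symm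
      refine ⟨γ, a, F ^ 2, (sub_pos.mpr hle).le, hF2.le, Or.inr hF2, ⟨1, le_rfl, ?_⟩, ⟨1, le_rfl, ?_⟩⟩
      · rw [act_sq, mulv_mul, h2, mulv_inv_mulv, one_smul]
      · rw [act_mul, h3, act_inv_act, one_smul]

/-! ### Strict decrease of pairings and their signs -/

/-- The pairings of the endpoints of the two lines decrease strictly under `(G, G')`. -/
def PairingsDecrease (G G' M M' : SL(2, ℝ)) : Prop :=
  ∀ i j : Fin 2, det2 (col (G * M) i) (col (G' * M') j) ^ 2 < det2 (col M i) (col M' j) ^ 2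

/-- The cone is self-dual: `|B B'|` is at most the geometric mean of `A C'` and `C A'`, hence at
most their arithmetic mean. -/
lemma bil_nonneg {X Y : Form} (hX : InCone X) (hY : InCone Y) : 0 ≤ bil X Y := by
  obtain ⟨hA, hC, hd, -⟩ := hX
  obtain ⟨hA', hC', hd', -⟩ := hY
  simp only [qdet, bil] at *
  have h1 : (2 * |X.2.1 * Y.2.1|) ^ 2 ≤ (X.1 * Y.2.2 + X.2.2 * Y.1) ^ 2 := by
    rw [mul_pow, sq_abs]
    have := mul_le_mul (sub_nonneg.mp hd) (sub_nonneg.mp hd') (sq_nonneg _) (mul_nonneg hA hC)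
    nlinarith [sq_nonneg (X.1 * Y.2.2 - X.2.2 * Y.1)]
  have h2 := le_of_sq_le_sq h1 (by positivity)
  linarith [le_abs_self (X.2.1 * Y.2.1)]

/-- Invariance under `γ` gives `bil X X' = μ μ' bil (G X) (G' X')`, and the eigenvalues lie in `(0,
1]`. This is the obstruction to a common element of two crooked planes or half-spaces. -/
lemma NonexpandingEigen.bil_le {G G' γ : SL(2, ℝ)} {X X' : Form}
    (h : NonexpandingEigen (G⁻¹ * γ) X) (h' : NonexpandingEigen (G'⁻¹ * γ) X')
    (hX : InCone X) (hX' : InCone X') :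
    bil X X' ≤ bil (act G X) (act G' X') := by
  obtain ⟨μ, hμ, h⟩ := h
  obtain ⟨μ', hμ', h'⟩ := h'
  have pos : ∀ {H : SL(2, ℝ)} {μ : ℝ} {X : Form}, InCone X → act H X = μ • X → 0 ≤ μ := by
    intro H μ X hX h
    have h1 := hX.trace_pos
    have h2 := (hX.act H).trace_pos
    rw [h] at h2
    simp only [Prod.smul_fst, Prod.smul_snd, smul_eq_mul, ← mul_add] at h2
    exact (pos_of_mul_pos_left h2 h1.le).le
  have e : act γ X = μ • act G X := by
    rw [← act_smul, ← h, act_mul, act_act_inv]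
  have e' : act γ X' = μ' • act G' X' := by
    rw [← act_smul, ← h', act_mul, act_act_inv]
  rw [← bil_act γ, e, e', bil_smul_left, bil_smul_right]
  have hb := bil_nonneg (hX.act G) (hX'.act G')
  have p := pos hX h
  have p' := pos hX' h'
  calc μ * (μ' * bil (act G X) (act G' X'))
      ≤ 1 * (1 * bil (act G X) (act G' X')) := by gcongr
    _ = _ := by ring

lemma inCone_coord {X : Form} (hX : InCone X) : 0 < X.1 ∨ 0 < X.2.2 := by
  by_contra! h
  linarith [hX.trace_pos, h.1, h.2]

/-- Strict decrease of `bil` between the two lines. -/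
lemma PairingsDecrease.bil_lt {G G' M M' : SL(2, ℝ)} (h : PairingsDecrease G G' M M')
    {X X' : Form} (hX : InCone X) (hX' : InCone X') (h0 : X.2.1 = 0) (h0' : X'.2.1 = 0) :
    bil (act (G * M) X) (act (G' * M') X') < bil (act M X) (act M' X') := by
  rw [bil_act_act, bil_act_act, h0, h0']
  have h00 := h 0 0
  have h01 := h 0 1
  have h10 := h 1 0
  have h11 := h 1 1
  have p := hX.1
  have q := hX.2.1
  have p' := hX'.1
  have q' := hX'.2.1
  have a00 := mul_nonneg (mul_nonneg p p') (sub_pos.mpr h00).le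
  have a01 := mul_nonneg (mul_nonneg p q') (sub_pos.mpr h01).le
  have a10 := mul_nonneg (mul_nonneg q p') (sub_pos.mpr h10).le
  have a11 := mul_nonneg (mul_nonneg q q') (sub_pos.mpr h11).le
  rcases inCone_coord hX with k | k <;> rcases inCone_coord hX' with k' | k'
  · have := mul_pos (mul_pos k k') (sub_pos.mpr h00); nlinarith
  · have := mul_pos (mul_pos k k') (sub_pos.mpr h01); nlinarith
  · have := mul_pos (mul_pos k k') (sub_pos.mpr h10); nlinarith
  · have := mul_pos (mul_pos k k') (sub_pos.mpr h11); nlinarith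

/-- The pairings of the endpoints of the two lines all have the same sign. -/
def SameSign (M M' : SL(2, ℝ)) : Prop :=
  ∃ s : ℝ, (s = 1 ∨ s = -1) ∧ ∀ i j : Fin 2, 0 < s * det2 (col M i) (col M' j)

lemma SameSign.mul_pos {M M' : SL(2, ℝ)} (h : SameSign M M') (i j k l : Fin 2) :
    0 < det2 (col M i) (col M' j) * det2 (col M k) (col M' l) := by
  obtain ⟨s, hs, h⟩ := h
  have := _root_.mul_pos (h i j) (h k l)
  rcases hs with rfl | rfl <;> nlinarith

/-- Strict decrease of `bil` between two half-planes facing away from each other. -/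
lemma PairingsDecrease.bil_lt_of_sameSign {G G' M M' : SL(2, ℝ)} (h : PairingsDecrease G G' M M')
    (hs : SameSign M M') {X X' : Form} (hX : InCone X) (hX' : InCone X') (h0 : 0 ≤ X.2.1)
    (h0' : 0 ≤ X'.2.1) :
    bil (act (G * M) X) (act (G' * M') X') < bil (act M X) (act M' X') := by
  -- Each factor decreases in absolute value and the product on the right is positive, so the signs
  -- of the new pairings do not matter.
  have key : ∀ i j k l : Fin 2,
      det2 (col (G * M) i) (col (G' * M') j) * det2 (col (G * M) k) (col (G' * M') l) ≤
        det2 (col M i) (col M' j) * det2 (col M k) (col M' l) := by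
    intro i j k l
    apply le_of_sq_le_sq _ (hs.mul_pos i j k l).le
    rw [mul_pow, mul_pow]
    exact mul_le_mul (h i j).le (h k l).le (sq_nonneg _) (sq_nonneg _)
  have base := h.bil_lt (X := (X.1, 0, X.2.2)) (X' := (X'.1, 0, X'.2.2))
    ⟨hX.1, hX.2.1, by simpa [qdet] using mul_nonneg hX.1 hX.2.1, fun e => by
      have := hX.trace_pos
      simp only [Prod.ext_iff, Prod.fst_zero, Prod.snd_zero] at e
      linarith [e.1, e.2.2]⟩
    ⟨hX'.1, hX'.2.1, by simpa [qdet] using mul_nonneg hX'.1 hX'.2.1, fun e => by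
      have := hX'.trace_pos
      simp only [Prod.ext_iff, Prod.fst_zero, Prod.snd_zero] at e
      linarith [e.1, e.2.2]⟩ rfl rfl
  rw [bil_act_act, bil_act_act] at base ⊢
  simp only [mul_zero, zero_mul, add_zero] at base
  have p := hX.1
  have q := hX.2.1
  have p' := hX'.1
  have q' := hX'.2.1
  have t1 := mul_le_mul_of_nonneg_left (key 0 0 0 1) (mul_nonneg zero_le_two (mul_nonneg p h0'))
  have t2 := mul_le_mul_of_nonneg_left (key 0 0 1 0) (mul_nonneg zero_le_two (mul_nonneg h0 p'))
  have t3 := mul_le_mul_of_nonneg_left (key 0 1 1 1) (mul_nonneg zero_le_two (mul_nonneg h0 q'))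
  have t4 := mul_le_mul_of_nonneg_left (key 1 0 1 1) (mul_nonneg zero_le_two (mul_nonneg q h0'))
  have t5 := mul_le_mul_of_nonneg_left (add_le_add (key 0 0 1 1) (key 0 1 1 0))
    (mul_nonneg zero_le_two (mul_nonneg h0 h0'))
  linarith

/-- Every product of pairings in `act_inv_mul_coord` is positive, so the closed positive side of
`M'` lies strictly on the negative side of `M`. -/
lemma SameSign.coord_neg {M M' : SL(2, ℝ)} (hs : SameSign M M') {X : Form} (hX : InCone X)
    (h0 : 0 ≤ X.2.1) : (act M⁻¹ (act M' X)).2.1 < 0 := by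
  rw [act_inv_mul_coord]
  have p := hX.1
  have q := hX.2.1
  have a1 := hs.mul_pos 0 0 1 0
  have a2 := hs.mul_pos 0 1 1 1
  have b := mul_nonneg h0 (add_pos (hs.mul_pos 0 0 1 1) (hs.mul_pos 0 1 1 0)).le
  have c1 := mul_nonneg p a1.le
  have c2 := mul_nonneg q a2.le
  rcases inCone_coord hX with k | k
  · have := _root_.mul_pos k a1; linarith
  · have := _root_.mul_pos k a2; linarith

/-- If the pairings are nonzero but not all of the same sign, the open arcs intersect. -/
lemma exists_common_vector {M M' : SL(2, ℝ)}
    (h0 : ∀ i j : Fin 2, det2 (col M i) (col M' j) ≠ 0) (hs : ¬ SameSign M M') :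
    ∃ s t : ℝ, 0 < s ∧ 0 < t ∧ det2 (col M 0 + s • col M 1) (col M' 0 + t • col M' 1) = 0 := by
  have hdet := det_pairing M M'
  have expand : ∀ s t : ℝ, det2 (col M 0 + s • col M 1) (col M' 0 + t • col M' 1) =
      (det2 (col M 0) (col M' 0) + t * det2 (col M 0) (col M' 1)) +
        s * (det2 (col M 1) (col M' 0) + t * det2 (col M 1) (col M' 1)) := by
    intro s t
    simp only [det2, Prod.fst_add, Prod.snd_add, Prod.smul_fst, Prod.smul_snd, smul_eq_mul]; ring
  simp only [expand]
  have hs' : ∀ s : ℝ, (s = 1 ∨ s = -1) → ¬ (0 < s * det2 (col M 0) (col M' 0) ∧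
      0 < s * det2 (col M 0) (col M' 1) ∧ 0 < s * det2 (col M 1) (col M' 0) ∧
      0 < s * det2 (col M 1) (col M' 1)) := by
    rintro s h ⟨h1, h2, h3, h4⟩
    refine hs ⟨s, h, fun i j => ?_⟩
    fin_cases i <;> fin_cases j <;> assumption
  have h1 := hs' 1 (Or.inl rfl)
  have h2 := hs' (-1) (Or.inr rfl)
  have ha := h0 0 0
  have hb := h0 0 1
  have hc := h0 1 0
  have hd := h0 1 1
  clear hs hs' h0 expand
  generalize det2 (col M 0) (col M' 0) = a at *
  generalize det2 (col M 0) (col M' 1) = b at *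
  generalize det2 (col M 1) (col M' 0) = c at *
  generalize det2 (col M 1) (col M' 1) = d at *
  -- For fixed `t` the equation is linear in `s`; its root is positive exactly when the two
  -- coefficients have opposite signs. The product of the coefficients has the sign of `a * c` near
  -- `t = 0` and of `b * d` for large `t`.
  suffices H : ∃ t : ℝ, 0 < t ∧ (a + t * b) * (c + t * d) < 0 by
    obtain ⟨t, ht, h⟩ := H
    have hcd : c + t * d ≠ 0 := fun e => by rw [e] at h; simp at h
    refine ⟨-(a + t * b) / (c + t * d), t, ?_, ht, by field_simp; ring⟩
    have : -(a + t * b) / (c + t * d) = -((a + t * b) * (c + t * d)) / (c + t * d) ^ 2 := by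
      field_simp
    rw [this]
    have := sq_pos_of_ne_zero hcd
    exact div_pos (by linarith) this
  have cont : Continuous fun t : ℝ => (a + t * b) * (c + t * d) := by fun_prop
  rcases lt_or_gt_of_ne (mul_ne_zero ha hc) with hac | hac
  · have : ∀ᶠ t in 𝓝[>] (0 : ℝ), (a + t * b) * (c + t * d) < 0 :=
      (cont.continuousAt.eventually_lt_const (by simpa using hac)).filter_mono nhdsWithin_le_nhds
    obtain ⟨t, h, ht⟩ := (this.and self_mem_nhdsWithin).exists
    exact ⟨t, ht, h⟩
  rcases lt_or_gt_of_ne (mul_ne_zero hb hd) with hbd | hbd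
  · have cont : Continuous fun t : ℝ => (t * a + b) * (t * c + d) := by fun_prop
    have : ∀ᶠ t in 𝓝[>] (0 : ℝ), (t * a + b) * (t * c + d) < 0 :=
      (cont.continuousAt.eventually_lt_const (by simpa using hbd)).filter_mono nhdsWithin_le_nhds
    obtain ⟨t, h, ht⟩ := (this.and self_mem_nhdsWithin).exists
    have ht : 0 < t := ht
    refine ⟨t⁻¹, inv_pos.mpr ht, ?_⟩
    have e : (a + t⁻¹ * b) * (c + t⁻¹ * d) = (t * a + b) * (t * c + d) * (t⁻¹) ^ 2 := by field_simp
    rw [e]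
    exact mul_neg_of_neg_of_pos h (by positivity)
  have hab : a * b < 0 := by
    refine lt_of_le_of_ne (not_lt.mp fun hab => ?_) (mul_ne_zero ha hb)
    rcases lt_or_gt_of_ne ha with k | k
    · refine h2 ⟨by linarith, ?_, ?_, ?_⟩ <;> nlinarith [mul_pos_of_neg_of_neg k k,
        neg_of_mul_pos_right hab k.le, neg_of_mul_pos_right hac k.le]
    · have kb := pos_of_mul_pos_right hab k.le
      have kc := pos_of_mul_pos_right hac k.le
      have kd := pos_of_mul_pos_right hbd kb.le
      exact h1 ⟨by linarith, by linarith, by linarith, by linarith⟩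
  have hcd : c * d < 0 := by
    by_contra! hcd
    have : 0 < (a * c) * (b * d) := mul_pos hac hbd
    nlinarith
  -- With `a * c` and `b * d` both positive, the two linear factors have positive roots, distinct
  -- because `a * d - b * c = 1`. Their product is negative at the midpoint of the roots.
  refine ⟨(-(a / b) + -(c / d)) / 2, ?_, ?_⟩
  · have k1 : 0 < -(a / b) := by
      have : -(a / b) = -(a * b) / b ^ 2 := by field_simp
      rw [this]; exact div_pos (by linarith) (by positivity)
    have k2 : 0 < -(c / d) := by
      have : -(c / d) = -(c * d) / d ^ 2 := by field_simp
      rw [this]; exact div_pos (by linarith) (by positivity)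
    linarith
  · have e : (a + (-(a / b) + -(c / d)) / 2 * b) * (c + (-(a / b) + -(c / d)) / 2 * d) =
        -((a * d - b * c) ^ 2 / (4 * (b * d))) := by field_simp; ring
    rw [e, hdet]
    have : 0 < (1 : ℝ) ^ 2 / (4 * (b * d)) := by positivity
    linarith

/-! ### The hyperbolic plane and its compactification as sets of positive matrices -/

/-- The point of the hyperboloid model corresponding to a point of the upper half-plane. -/
noncomputable def pt (z : ℍ) : Form := ((z.re ^ 2 + z.im ^ 2) / z.im, z.re / z.im, 1 / z.im)

lemma qdet_pt (z : ℍ) : qdet (pt z) = 1 := by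
  have := z.im_pos
  simp only [qdet, pt]; field_simp; ring

lemma inCone_pt (z : ℍ) : InCone (pt z) := by
  have := z.im_pos
  refine ⟨by simp only [pt]; positivity, by simp only [pt]; positivity, by simp [qdet_pt], ?_⟩
  intro h
  have h2 := qdet_pt z
  rw [h] at h2
  simp [qdet] at h2

lemma pt_injective : Function.Injective pt := by
  intro z w h
  have hz := z.im_pos
  have hw := w.im_pos
  simp only [pt, Prod.mk.injEq] at h
  have him : z.im = w.im := by simpa using h.2.2
  have hre : z.re = w.re := by
    have := h.2.1
    rw [him] at this
    field_simp at this
    exact this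
  exact UpperHalfPlane.ext (Complex.ext hre him)

lemma exists_pt {X : Form} (hX : InCone X) (h : qdet X = 1) : ∃ z, pt z = X := by
  obtain ⟨hA, hC, -, -⟩ := hX
  simp only [qdet] at h
  have hC' : 0 < X.2.2 := by
    refine lt_of_le_of_ne hC fun e => ?_
    rw [← e] at h; nlinarith [sq_nonneg X.2.1]
  refine ⟨⟨⟨X.2.1 / X.2.2, 1 / X.2.2⟩, by simpa using hC'⟩, ?_⟩
  simp only [pt, UpperHalfPlane.re, UpperHalfPlane.im]
  ext
  · simp; field_simp; linarith
  · simp; field_simp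
  · simp

lemma pt_smul (g : SL(2, ℝ)) (z : ℍ) : pt (g • z) = act g (pt z) := by
  have hz := z.im_pos
  have hw := (g • z).im_pos
  have hd := det_eq g
  have hc := UpperHalfPlane.coe_specialLinearGroup_apply g z
  have hden : ((g 1 0 : ℝ) : ℂ) * z + ((g 1 1 : ℝ) : ℂ) ≠ 0 := by
    intro e
    have e1 := congrArg Complex.re e
    have e2 := congrArg Complex.im e
    simp at e1 e2
    rcases e2 with e2 | e2
    · rw [e2] at e1 hd; simp at e1; rw [e1] at hd; simp at hd
    · exact hz.ne' e2
  simp only [Algebra.algebraMap_self, RingHom.id_apply] at hc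
  rw [eq_div_iff hden] at hc
  have e1 := congrArg Complex.re hc
  have e2 := congrArg Complex.im hc
  simp at e1 e2
  simp only [pt, act]
  set w := g • z
  generalize g 0 0 = a at *
  generalize g 0 1 = b at *
  generalize g 1 0 = c at *
  generalize g 1 1 = d at *
  -- `e3`, `e4` and `e5` are the Möbius formulas for `Im w`, `Re w` and `|w|²`, multiplied by `|c z
  -- + d|²`.
  have e3 : w.im * ((c * z.re + d) ^ 2 + (c * z.im) ^ 2) = z.im := by
    linear_combination (c * z.re + d) * e2 - c * z.im * e1 + z.im * hd
  have e4 : w.re * ((c * z.re + d) ^ 2 + (c * z.im) ^ 2) =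
      (a * z.re + b) * (c * z.re + d) + a * c * z.im ^ 2 := by
    linear_combination (c * z.re + d) * e1 + c * z.im * e2
  have e5 : (w.re ^ 2 + w.im ^ 2) * ((c * z.re + d) ^ 2 + (c * z.im) ^ 2) =
      (a * z.re + b) ^ 2 + (a * z.im) ^ 2 := by
    linear_combination (w.re * (c * z.re + d) - w.im * (c * z.im) + (a * z.re + b)) * e1 +
      (w.re * (c * z.im) + w.im * (c * z.re + d) + a * z.im) * e2
  have hN : 0 < (c * z.re + d) ^ 2 + (c * z.im) ^ 2 := by
    by_contra! hN
    nlinarith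
  ext
  · rw [div_eq_iff hw.ne']
    apply mul_right_cancel₀ hN.ne'
    rw [e5, mul_assoc, e3]
    field_simp
    ring
  · rw [div_eq_iff hw.ne']
    apply mul_right_cancel₀ hN.ne'
    simp only
    rw [e4, mul_assoc _ w.im, e3]
    field_simp
    ring
  · simp only
    rw [div_eq_iff hw.ne']
    apply mul_right_cancel₀ hN.ne'
    rw [mul_assoc, e3]
    field_simp
    ring

lemma cosh_dist_eq (z w : ℍ) : Real.cosh (dist z w) = bil (pt z) (pt w) / 2 := by
  have hz := z.im_pos
  have hw := w.im_pos
  rw [UpperHalfPlane.cosh_dist, Complex.dist_eq, Complex.sq_norm, Complex.normSq_apply]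
  simp only [bil, pt, Complex.sub_re, Complex.sub_im, UpperHalfPlane.coe_re, UpperHalfPlane.coe_im]
  field_simp
  ring

/-! ### The Klein model of the compactified plane -/

/-- The positive matrix of trace one corresponding to a point of the Riemann sphere. -/
noncomputable def sig (p : OnePoint ℂ) : Form :=
  p.elim (1, 0, 0) fun z =>
    (Complex.normSq z / (1 + Complex.normSq z), z.re / (1 + Complex.normSq z),
      1 / (1 + Complex.normSq z))

lemma sig_infty : sig OnePoint.infty = (1, 0, 0) := rfl

lemma sig_coe (z : ℂ) : sig z = (Complex.normSq z / (1 + Complex.normSq z),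
    z.re / (1 + Complex.normSq z), 1 / (1 + Complex.normSq z)) := rfl

lemma one_add_normSq_pos (z : ℂ) : 0 < 1 + Complex.normSq z := by
  have := Complex.normSq_nonneg z; linarith

lemma continuous_sig : Continuous sig := by
  rw [OnePoint.continuous_iff]
  constructor
  · rw [coclosedCompact_eq_cocompact]
    have h1 : Tendsto (fun z : ℂ => 1 + Complex.normSq z) (cocompact ℂ) atTop := by
      refine tendsto_atTop_add_const_left _ _ ?_
      have := (tendsto_pow_atTop (α := ℝ) two_ne_zero).comp (tendsto_norm_cocompact_atTop (E := ℂ))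
      refine this.congr fun z => ?_
      simp [Complex.normSq_eq_norm_sq]
    have h2 : Tendsto (fun z : ℂ => 1 / (1 + Complex.normSq z)) (cocompact ℂ) (𝓝 0) := by
      simpa [Pi.inv_def] using h1.inv_tendsto_atTop
    refine Tendsto.prodMk_nhds ?_ (Tendsto.prodMk_nhds ?_ h2)
    · have h3 : Tendsto (fun z : ℂ => 1 - 1 / (1 + Complex.normSq z)) (cocompact ℂ) (𝓝 1) := by
        simpa using h2.const_sub 1
      refine h3.congr fun z => ?_
      have := one_add_normSq_pos z
      field_simp; ring
    · have h3 : Tendsto (fun z : ℂ => √(1 / (1 + Complex.normSq z))) (cocompact ℂ) (𝓝 0) := by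
        simpa using h2.sqrt
      refine squeeze_zero_norm (fun z => ?_) h3
      have := one_add_normSq_pos z
      apply Real.le_sqrt_of_sq_le
      rw [Real.norm_eq_abs, sq_abs, div_pow, div_le_div_iff₀ (by positivity) this]
      have h4 : z.re ^ 2 ≤ 1 + Complex.normSq z := by
        rw [Complex.normSq_apply]; nlinarith [sq_nonneg z.im]
      nlinarith
  · simp only [sig_coe]
    have := fun z => (one_add_normSq_pos z).ne'
    refine Continuous.prodMk ?_ (Continuous.prodMk ?_ ?_) <;>
      refine Continuous.div ?_ ?_ this <;> fun_prop

lemma sig_trace (p : OnePoint ℂ) : (sig p).1 + (sig p).2.2 = 1 := by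
  induction p using OnePoint.rec with
  | infty => simp [sig_infty]
  | coe z =>
    have := one_add_normSq_pos z
    rw [sig_coe]; field_simp; ring

lemma qdet_sig_coe (z : ℂ) : qdet (sig z) = z.im ^ 2 / (1 + Complex.normSq z) ^ 2 := by
  have := one_add_normSq_pos z
  rw [sig_coe]
  simp only [qdet]
  field_simp
  rw [Complex.normSq_apply]; ring

lemma inCone_sig (p : OnePoint ℂ) : InCone (sig p) := by
  have h0 : sig p ≠ 0 := fun h => by
    have := sig_trace p
    rw [h] at this
    simp at this
  induction p using OnePoint.rec with
  | infty => exact ⟨by simp [sig_infty], by simp [sig_infty], by simp [sig_infty, qdet], h0⟩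
  | coe z =>
    have := one_add_normSq_pos z
    have h' := Complex.normSq_nonneg z
    refine ⟨?_, ?_, ?_, h0⟩
    · rw [sig_coe]; positivity
    · rw [sig_coe]; positivity
    · rw [qdet_sig_coe]; positivity

lemma sig_toSphere (z : ℍ) :
    sig (toSphere z) = (z.im / (1 + Complex.normSq z)) • pt z := by
  have := z.im_pos
  have h := one_add_normSq_pos z
  have h' : Complex.normSq z = z.re ^ 2 + z.im ^ 2 := by
    rw [Complex.normSq_apply, UpperHalfPlane.coe_re, UpperHalfPlane.coe_im]; ring
  rw [toSphere, sig_coe, pt]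
  ext
  · simp only [Prod.smul_fst, smul_eq_mul, ← h']; field_simp
  · simp only [Prod.smul_snd, Prod.smul_fst, smul_eq_mul, UpperHalfPlane.coe_re]; field_simp
  · simp only [Prod.smul_snd, smul_eq_mul]; field_simp

lemma mem_closedPlane {p : OnePoint ℂ} :
    p ∈ closedPlane ↔ p = OnePoint.infty ∨ ∃ z : ℂ, 0 ≤ z.im ∧ p = z := by
  constructor
  · intro hp
    by_contra! h
    obtain ⟨h1, h2⟩ := h
    have hU : IsOpen ((↑) '' {z : ℂ | z.im < 0} : Set (OnePoint ℂ)) :=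
      OnePoint.isOpen_image_coe.mpr (isOpen_lt Complex.continuous_im continuous_const)
    induction p using OnePoint.rec with
    | infty => exact h1 rfl
    | coe z =>
      have hz : z.im < 0 := by
        by_contra! hz
        exact h2 z hz rfl
      obtain ⟨q, ⟨w, hw, rfl⟩, ⟨x, hx⟩⟩ := mem_closure_iff.mp hp _ hU ⟨z, hz, rfl⟩
      have hxw : (x : ℂ) = w := OnePoint.coe_injective hx
      have := x.im_pos
      rw [← UpperHalfPlane.coe_im, hxw] at this
      exact absurd hw (not_lt.mpr this.le)
  · have key : ∀ z : ℂ, 0 ≤ z.im → (z : OnePoint ℂ) ∈ closedPlane := by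
      intro z hz
      have h1 : Tendsto (fun t : ℝ => z + t * Complex.I) (𝓝[>] 0) (𝓝 z) := by
        have : Continuous fun t : ℝ => z + t * Complex.I := by fun_prop
        have := (this.tendsto 0).mono_left (nhdsWithin_le_nhds (s := Ioi 0))
        simpa using this
      refine mem_closure_of_tendsto ((OnePoint.continuous_coe.tendsto z).comp h1) ?_
      filter_upwards [self_mem_nhdsWithin] with t ht
      have ht : 0 < t := ht
      exact ⟨⟨z + t * Complex.I, by simp; linarith⟩, rfl⟩
    rintro (rfl | ⟨z, hz, rfl⟩)
    · have h1 : Tendsto (fun t : ℝ => ((t : ℂ) * Complex.I)) atTop (cocompact ℂ) := by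
        rw [← Metric.cobounded_eq_cocompact, ← tendsto_norm_atTop_iff_cobounded]
        simpa using tendsto_abs_atTop_atTop
      have h2 := (OnePoint.tendsto_coe_infty (X := ℂ))
      rw [coclosedCompact_eq_cocompact] at h2
      refine mem_closure_of_tendsto (h2.comp h1) ?_
      filter_upwards [eventually_gt_atTop 0] with t ht
      exact ⟨⟨t * Complex.I, by simpa using ht⟩, rfl⟩
    · exact key z hz

lemma toSphere_mem_closedPlane (z : ℍ) : toSphere z ∈ closedPlane :=
  subset_closure (mem_range_self z)

lemma isClosed_closedPlane : IsClosed closedPlane := isClosed_closure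

/-- The restriction is essential: `sig` depends only on `Re z` and `|z|²`, so it identifies
conjugate points. The sign of the imaginary part settles the ambiguity. -/
lemma sig_injOn : InjOn sig closedPlane := by
  intro p hp q hq h
  rcases mem_closedPlane.mp hp with rfl | ⟨z, hz, rfl⟩ <;>
    rcases mem_closedPlane.mp hq with rfl | ⟨w, hw, rfl⟩
  · rfl
  · have := one_add_normSq_pos w
    have h2 := congrArg (fun X : Form => X.2.2) h
    simp only [sig_infty, sig_coe] at h2
    exact absurd h2.symm (by positivity)
  · have := one_add_normSq_pos z
    have h2 := congrArg (fun X : Form => X.2.2) h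
    simp only [sig_infty, sig_coe] at h2
    exact absurd h2 (by positivity)
  · have h1 := one_add_normSq_pos w
    have h2 := one_add_normSq_pos z
    rw [sig_coe, sig_coe, Prod.mk.injEq, Prod.mk.injEq] at h
    have hn : Complex.normSq z = Complex.normSq w := by
      have := h.2.2
      field_simp at this
      linarith
    have hre : z.re = w.re := by
      have := h.2.1
      rw [hn] at this
      field_simp at this
      exact this
    have him : z.im = w.im := by
      rw [Complex.normSq_apply, Complex.normSq_apply, hre] at hn
      nlinarith
    rw [Complex.ext hre him]

lemma exists_sig {X : Form} (hX : InCone X) :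
    ∃ p ∈ closedPlane, ∃ c : ℝ, 0 < c ∧ X = c • sig p := by
  obtain ⟨hA, hC, hd, h0⟩ := id hX
  rcases hC.eq_or_lt with h | h
  · have hB : X.2.1 = 0 := by
      simp only [qdet] at hd
      rw [← h] at hd; nlinarith [sq_nonneg X.2.1]
    refine ⟨OnePoint.infty, mem_closedPlane.mpr (Or.inl rfl), X.1, ?_, ?_⟩
    · have := hX.trace_pos; linarith
    · rw [sig_infty]; ext <;> simp [hB, ← h]
  -- The root in the closed upper half-plane of `C z² - 2 B z + A`.
  · set z : ℂ := ⟨X.2.1 / X.2.2, √(qdet X) / X.2.2⟩ with hz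
    have h1 := one_add_normSq_pos z
    refine ⟨(z : ℂ), mem_closedPlane.mpr (Or.inr ⟨z, by simp only [hz]; positivity, rfl⟩),
      X.2.2 * (1 + Complex.normSq z), by positivity, ?_⟩
    have hn : Complex.normSq z = X.1 / X.2.2 := by
      have := Real.mul_self_sqrt hd
      rw [Complex.normSq_apply]
      simp only [hz]
      field_simp
      rw [Real.sq_sqrt hd]; simp only [qdet]; ring
    rw [sig_coe]
    ext
    · simp only [Prod.smul_fst, smul_eq_mul]
      field_simp
      rw [hn]; field_simp
    · simp only [Prod.smul_fst, Prod.smul_snd, smul_eq_mul]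
      field_simp
      simp only [hz]; field_simp
    · simp only [Prod.smul_snd, smul_eq_mul]
      field_simp

lemma exists_sig_eq {X : Form} (hX : InCone X) (h : X.1 + X.2.2 = 1) :
    ∃ p ∈ closedPlane, sig p = X := by
  obtain ⟨p, hp, c, hc, rfl⟩ := exists_sig hX
  have := sig_trace p
  simp only [Prod.smul_fst, Prod.smul_snd, smul_eq_mul, ← mul_add, this, mul_one] at h
  exact ⟨p, hp, by rw [h, one_smul]⟩

lemma qdet_sig_pos_iff {p : OnePoint ℂ} (hp : p ∈ closedPlane) :
    0 < qdet (sig p) ↔ ∃ z : ℍ, p = toSphere z := by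
  constructor
  · intro h
    rcases mem_closedPlane.mp hp with rfl | ⟨z, hz, rfl⟩
    · simp [sig_infty, qdet] at h
    · refine ⟨⟨z, lt_of_le_of_ne hz fun e => ?_⟩, rfl⟩
      rw [qdet_sig_coe, ← e] at h
      simp at h
  · rintro ⟨z, rfl⟩
    have := z.im_pos
    have h := one_add_normSq_pos z
    rw [sig_toSphere, qdet_smul, qdet_pt]
    positivity

lemma mem_idealBoundary {p : OnePoint ℂ} :
    p ∈ idealBoundary ↔ p ∈ closedPlane ∧ qdet (sig p) = 0 := by
  constructor
  · rintro ⟨h1, h2⟩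
    refine ⟨h1, le_antisymm (not_lt.mp fun h => h2 ?_) (inCone_sig p).2.2.1⟩
    obtain ⟨z, rfl⟩ := (qdet_sig_pos_iff h1).mp h
    exact mem_range_self z
  · rintro ⟨h1, h2⟩
    refine ⟨h1, ?_⟩
    rintro ⟨z, rfl⟩
    exact ((qdet_sig_pos_iff h1).mpr ⟨z, rfl⟩).ne' h2

/-! ### Equivariance of the Klein model -/

lemma mapGL_entry (g : SL(2, ℝ)) (i j : Fin 2) :
    (Matrix.SpecialLinearGroup.mapGL ℂ g : GL (Fin 2) ℂ) i j = ((g i j : ℝ) : ℂ) := rfl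

lemma smul_infty_of_eq_zero {g : SL(2, ℝ)} (h : g 1 0 = 0) :
    (g : G₀) • (OnePoint.infty : OnePoint ℂ) = OnePoint.infty := by
  change (Matrix.SpecialLinearGroup.mapGL ℂ g) • (OnePoint.infty : OnePoint ℂ) = _
  rw [OnePoint.smul_infty_eq_ite, mapGL_entry, if_pos (by rw [h, Complex.ofReal_zero])]

lemma smul_infty_of_ne_zero {g : SL(2, ℝ)} (h : g 1 0 ≠ 0) :
    (g : G₀) • (OnePoint.infty : OnePoint ℂ) = ((g 0 0 / g 1 0 : ℝ) : ℂ) := by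
  change (Matrix.SpecialLinearGroup.mapGL ℂ g) • (OnePoint.infty : OnePoint ℂ) = _
  rw [OnePoint.smul_infty_eq_ite, mapGL_entry, mapGL_entry,
    if_neg (by rwa [Complex.ofReal_eq_zero]), Complex.ofReal_div]

lemma smul_coe_of_eq_zero {g : SL(2, ℝ)} {z : ℂ} (h : (g 1 0 : ℂ) * z + g 1 1 = 0) :
    (g : G₀) • (z : OnePoint ℂ) = OnePoint.infty := by
  change (Matrix.SpecialLinearGroup.mapGL ℂ g) • (z : OnePoint ℂ) = _
  rw [OnePoint.smul_some_eq_ite, mapGL_entry, mapGL_entry, if_pos h]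

lemma smul_coe_of_ne_zero {g : SL(2, ℝ)} {z : ℂ} (h : (g 1 0 : ℂ) * z + g 1 1 ≠ 0) :
    (g : G₀) • (z : OnePoint ℂ) =
      (((g 0 0 : ℂ) * z + g 0 1) / ((g 1 0 : ℂ) * z + g 1 1) : ℂ) := by
  change (Matrix.SpecialLinearGroup.mapGL ℂ g) • (z : OnePoint ℂ) = _
  rw [OnePoint.smul_some_eq_ite, mapGL_entry, mapGL_entry, if_neg h]
  rfl

lemma smul_toSphere (g : SL(2, ℝ)) (z : ℍ) :
    (g : G₀) • toSphere z = toSphere (g • z) := by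
  unfold toSphere
  rw [smul_coe_of_ne_zero, UpperHalfPlane.coe_specialLinearGroup_apply]
  · rfl
  · intro e
    have e1 := congrArg Complex.re e
    have e2 := congrArg Complex.im e
    have hd := det_eq g
    simp at e1 e2
    rcases e2 with e2 | e2
    · rw [e2] at e1 hd; simp at e1; rw [e1] at hd; simp at hd
    · exact z.im_pos.ne' e2

/-- The Möbius action is the linear action on rays. The scalar restores trace one, and its
positivity keeps the rays in the cone. -/
lemma exists_sig_smul (g : SL(2, ℝ)) (p : OnePoint ℂ) :
    ∃ c : ℝ, 0 < c ∧ act g (sig p) = c • sig ((g : G₀) • p) := by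
  have hd := det_eq g
  induction p using OnePoint.rec with
  | infty =>
    by_cases h : g 1 0 = 0
    · rw [smul_infty_of_eq_zero h]
      simp only [sig_infty, act, h] at *
      generalize g 0 0 = a at *
      have ha : a ≠ 0 := by rintro rfl; simp at hd
      exact ⟨a ^ 2, by positivity, by ext <;> simp⟩
    · rw [smul_infty_of_ne_zero h]
      simp only [sig_infty, act]
      generalize g 0 0 = a at *
      generalize g 0 1 = b at *
      generalize g 1 0 = c at *
      generalize g 1 1 = d at *
      refine ⟨a ^ 2 + c ^ 2, by positivity, ?_⟩
      rw [sig_coe, Complex.normSq_ofReal, Complex.ofReal_re]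
      have hp : c ^ 2 + a ^ 2 ≠ 0 := by positivity
      ext
      · simp; field_simp; ring
      · simp; field_simp; ring
      · simp; field_simp; ring
  | coe z =>
    have h1 := one_add_normSq_pos z
    by_cases h : (g 1 0 : ℂ) * z + g 1 1 = 0
    · rw [smul_coe_of_eq_zero h]
      simp only [sig_coe, act]
      generalize g 0 0 = a at *
      generalize g 0 1 = b at *
      generalize g 1 0 = c at *
      generalize g 1 1 = d at *
      have e1 := congrArg Complex.re h
      have e2 := congrArg Complex.im h
      simp at e1 e2
      have hc : c ≠ 0 := by
        rintro rfl
        simp at e1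
        simp [e1] at hd
      have hy : z.im = 0 := by simpa [hc] using e2
      have hab : a * z.re + b ≠ 0 := by
        intro h
        have : c * (a * z.re + b) - a * (c * z.re + d) = -1 := by linear_combination -hd
        rw [h, e1] at this
        simp at this
      refine ⟨(a * z.re + b) ^ 2 / (1 + Complex.normSq z), by positivity, ?_⟩
      have hn : Complex.normSq z = z.re ^ 2 := by rw [Complex.normSq_apply, hy]; ring
      rw [sig_infty, hn]
      rw [hn] at h1
      ext
      · simp; field_simp; ring
      · simp; field_simp; linear_combination (a * z.re + b) * e1
      · simp; field_simp; linear_combination (c * z.re + d) * e1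
    · rw [smul_coe_of_ne_zero h]
      simp only [sig_coe, act]
      generalize g 0 0 = a at *
      generalize g 0 1 = b at *
      generalize g 1 0 = c at *
      generalize g 1 1 = d at *
      set w := ((a : ℂ) * z + b) / (c * z + d) with hw
      have hw := hw
      rw [eq_div_iff h] at hw
      have e1 := congrArg Complex.re hw
      have e2 := congrArg Complex.im hw
      simp at e1 e2
      have e4 : w.re * ((c * z.re + d) ^ 2 + (c * z.im) ^ 2) =
          (a * z.re + b) * (c * z.re + d) + a * c * z.im ^ 2 := by
        linear_combination (c * z.re + d) * e1 + c * z.im * e2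
      have e5 : (w.re ^ 2 + w.im ^ 2) * ((c * z.re + d) ^ 2 + (c * z.im) ^ 2) =
          (a * z.re + b) ^ 2 + (a * z.im) ^ 2 := by
        linear_combination (w.re * (c * z.re + d) - w.im * (c * z.im) + (a * z.re + b)) * e1 +
          (w.re * (c * z.im) + w.im * (c * z.re + d) + a * z.im) * e2
      have hD : 0 < (c * z.re + d) ^ 2 + (c * z.im) ^ 2 := by
        have := Complex.normSq_pos.mpr h
        rw [Complex.normSq_apply] at this
        simp at this
        linarith
      have h3 := one_add_normSq_pos w
      refine ⟨((c * z.re + d) ^ 2 + (c * z.im) ^ 2) * (1 + Complex.normSq w) /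
        (1 + Complex.normSq z), by positivity, ?_⟩
      have hnw : Complex.normSq w = w.re ^ 2 + w.im ^ 2 := by rw [Complex.normSq_apply]; ring
      have hnz : Complex.normSq z = z.re ^ 2 + z.im ^ 2 := by rw [Complex.normSq_apply]; ring
      rw [hnw] at h3 ⊢
      rw [hnz] at h1 ⊢
      clear_value w
      ext
      · simp only [Prod.smul_fst, smul_eq_mul]
        field_simp
        linear_combination -e5
      · simp only [Prod.smul_fst, Prod.smul_snd, smul_eq_mul]
        field_simp
        linear_combination -e4
      · simp only [Prod.smul_snd, smul_eq_mul]
        field_simp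
        ring

lemma smul_mem_closedPlane (g : SL(2, ℝ)) {p : OnePoint ℂ} (hp : p ∈ closedPlane) :
    (g : G₀) • p ∈ closedPlane := by
  rcases (inCone_sig p).2.2.1.eq_or_lt with h | h
  · obtain ⟨c, hc, e⟩ := exists_sig_smul g p
    have e := congrArg qdet e
    rw [qdet_act, ← h, qdet_smul] at e
    generalize (g : G₀) • p = q at *
    have hq : qdet (sig q) = 0 := by
      rcases mul_eq_zero.mp e.symm with h | h
      · exact absurd h (by positivity)
      · exact h
    induction q using OnePoint.rec with
    | infty => exact mem_closedPlane.mpr (Or.inl rfl)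
    | coe z =>
      rw [qdet_sig_coe, div_eq_zero_iff] at hq
      have := one_add_normSq_pos z
      rcases hq with h | h
      · exact mem_closedPlane.mpr (Or.inr ⟨z, by rw [pow_eq_zero_iff two_ne_zero] at h; rw [h], rfl⟩)
      · exact absurd h (by positivity)
  · obtain ⟨z, rfl⟩ := (qdet_sig_pos_iff hp).mp h
    rw [smul_toSphere]
    exact toSphere_mem_closedPlane _

/-- The Klein model is homeomorphic to the compactified plane. -/
lemma isClosedEmbedding_sig : IsClosedEmbedding fun p : closedPlane => sig p := by
  have : CompactSpace closedPlane := isCompact_iff_compactSpace.mp isClosed_closedPlane.isCompact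
  exact (continuous_sig.comp continuous_subtype_val).isClosedEmbedding fun p q h =>
    Subtype.ext (sig_injOn p.2 q.2 h)

/-! ### Nonattracting fixed points -/

lemma eq_or_eq_neg_of_coe_eq {A B : SL(2, ℝ)} (h : (A : G₀) = B) : B = A ∨ B = -A := by
  obtain ⟨r, hr, hr'⟩ := Matrix.SpecialLinearGroup.mem_center_iff.mp (QuotientGroup.eq.mp h)
  have hB : B = A * (A⁻¹ * B) := by group
  have hr2 : r = 1 ∨ r = -1 := by
    rw [Fintype.card_fin] at hr
    rw [pow_two] at hr
    exact mul_self_eq_one_iff.mp hr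
  rcases hr2 with rfl | rfl
  · left
    have : A⁻¹ * B = 1 := by
      apply Subtype.ext
      rw [← hr']; simp
    rw [hB, this, mul_one]
  · right
    have : A⁻¹ * B = -1 := by
      apply Subtype.ext
      rw [← hr']
      ext i j
      fin_cases i <;> fin_cases j <;> simp
    rw [hB, this, mul_neg, mul_one]

lemma isHyperbolic_coe_iff (H : SL(2, ℝ)) : IsHyperbolic (H : G₀) ↔ 4 < (H 0 0 + H 1 1) ^ 2 := by
  have key : ∀ A : SL(2, ℝ), A.1.IsHyperbolic ↔ 4 < (A 0 0 + A 1 1) ^ 2 := by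
    intro A
    rw [Matrix.IsHyperbolic, Matrix.discr_fin_two, Matrix.trace_fin_two, A.2]
    constructor <;> intro h <;> linarith
  constructor
  · rintro ⟨A, hA, h⟩
    rw [key] at h
    rcases eq_or_eq_neg_of_coe_eq hA with rfl | rfl
    · exact h
    · have : (-A) 0 0 + (-A) 1 1 = -(A 0 0 + A 1 1) := by simp; ring
      rwa [this, neg_sq]
  · intro h
    exact ⟨H, rfl, (key H).mpr h⟩

lemma act_pow_of_eigen {H : SL(2, ℝ)} {X : Form} {μ : ℝ} (h : act H X = μ • X) (n : ℕ) :
    act (H ^ n) X = μ ^ n • X := by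
  induction n with
  | zero => simp [act_one]
  | succ n ih => rw [pow_succ, act_mul, h, act_smul, ih, smul_smul, pow_succ, mul_comm]

/-- In trace one the cone is the disc of radius `1/2` in the coordinates `x = (A - 1/2, B)`, and
`bil` is `1/2 - 2 ⟨x, v⟩`. This equals `|x - v|²` when both points are on the circle and exceeds it
when only `v` is. Convergence to an ideal point can thus be read off `bil`. -/
lemma sq_dist_le_bil {X V : Form} (hX : InCone X) (hV : qdet V = 0) (tX : X.1 + X.2.2 = 1)
    (tV : V.1 + V.2.2 = 1) : (X.1 - V.1) ^ 2 + (X.2.1 - V.2.1) ^ 2 ≤ bil X V := by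
  have h := hX.2.2.1
  simp only [qdet, bil] at *
  obtain e : X.2.2 = 1 - X.1 := by linarith
  obtain e' : V.2.2 = 1 - V.1 := by linarith
  rw [e] at h ⊢
  rw [e'] at hV ⊢
  nlinarith

lemma pos_of_eigen {H : SL(2, ℝ)} {μ : ℝ} {X : Form} (hX : InCone X) (h : act H X = μ • X) :
    0 < μ := by
  have h1 := hX.trace_pos
  have h2 := (hX.act H).trace_pos
  rw [h] at h2
  simp only [Prod.smul_fst, Prod.smul_snd, smul_eq_mul, ← mul_add] at h2
  exact pos_of_mul_pos_left h2 h1.le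

lemma qdet_eq_zero_of_eigen {H : SL(2, ℝ)} {μ : ℝ} {X : Form} (hμ : 1 < μ)
    (h : act H X = μ • X) : qdet X = 0 := by
  have := congrArg qdet h
  rw [qdet_act, qdet_smul] at this
  have h2 : (μ ^ 2 - 1) * qdet X = 0 := by linarith
  rcases mul_eq_zero.mp h2 with h3 | h3
  · nlinarith
  · exact h3

lemma tendsto_of_tendsto_sig {ι : Type*} {F : Filter ι} {f : ι → OnePoint ℂ} {p : OnePoint ℂ}
    (hf : ∀ i, f i ∈ closedPlane) (hp : p ∈ closedPlane)
    (h : Tendsto (fun i => sig (f i)) F (𝓝 (sig p))) : Tendsto f F (𝓝 p) := by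
  have h1 : Tendsto (fun i => (⟨f i, hf i⟩ : closedPlane)) F (𝓝 ⟨p, hp⟩) := by
    rw [isClosedEmbedding_sig.isInducing.tendsto_nhds_iff]
    exact h
  exact (continuous_subtype_val.tendsto _).comp h1

/-- Invariance of `bil` under `H ^ n` makes the pairing of the normalised iterate with `sig p` decay
like `μ⁻ⁿ`, and this pairing dominates the squared distance in the Klein model. -/
lemma tendsto_pow_smul {H : SL(2, ℝ)} {p : OnePoint ℂ} {μ : ℝ} (hp : p ∈ closedPlane)
    (h : act H (sig p) = μ • sig p) (hμ : 1 < μ) (z : ℍ) :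
    Tendsto (fun n : ℕ => toSphere ((H : G₀) ^ n • z)) atTop (𝓝 p) := by
  have hq := qdet_eq_zero_of_eigen hμ h
  have mem : ∀ n : ℕ, toSphere ((H : G₀) ^ n • z) ∈ closedPlane :=
    fun n => toSphere_mem_closedPlane _
  have hX : 0 < qdet (sig (toSphere z)) :=
    (qdet_sig_pos_iff (toSphere_mem_closedPlane z)).mpr ⟨z, rfl⟩
  set X := sig (toSphere z) with hXdef
  have bound : ∀ n : ℕ, bil (sig (toSphere ((H : G₀) ^ n • z))) (sig p) ≤
      bil X (sig p) / (2 * √(qdet X)) * (μ⁻¹) ^ n := by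
    intro n
    have e1 : toSphere ((H : G₀) ^ n • z) = ((H ^ n : SL(2, ℝ)) : G₀) • toSphere z :=
      (smul_toSphere (H ^ n) z).symm
    obtain ⟨c, hc, e2⟩ := exists_sig_smul (H ^ n) (toSphere z)
    rw [← e1, ← hXdef] at e2
    set Y := sig (toSphere ((H : G₀) ^ n • z)) with hY
    have tY : Y.1 + Y.2.2 = 1 := sig_trace _
    have e3 : c * (μ ^ n * bil Y (sig p)) = bil X (sig p) := by
      rw [← bil_act (H ^ n) X, act_pow_of_eigen h, e2, bil_smul_left, bil_smul_right]
    have e4 : qdet X = c ^ 2 * qdet Y := by rw [← qdet_act (H ^ n), e2, qdet_smul]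
    -- A trace-one matrix has determinant at most `1/4`. As `qdet` is invariant, this bounds the
    -- normalising scalar `c` away from zero uniformly in `n`.
    have e5 : qdet Y ≤ 1 / 4 := by
      simp only [qdet]
      have : Y.2.2 = 1 - Y.1 := by linarith
      rw [this]
      nlinarith [sq_nonneg (Y.1 - 1 / 2), sq_nonneg Y.2.1]
    have e6 : 2 * √(qdet X) ≤ c := by
      have : √(qdet X) ≤ c / 2 := by
        rw [Real.sqrt_le_left (by positivity)]
        nlinarith [sq_nonneg c]
      linarith
    have hs : 0 < √(qdet X) := Real.sqrt_pos.mpr hX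
    have hb : 0 ≤ bil Y (sig p) := bil_nonneg (inCone_sig _) (inCone_sig _)
    have hμn : 0 < μ ^ n := by positivity
    rw [inv_pow, ← div_eq_mul_inv, le_div_iff₀ hμn, le_div_iff₀ (by positivity), ← e3]
    nlinarith [mul_nonneg hμn.le hb]
  have lim : Tendsto (fun n : ℕ => bil (sig (toSphere ((H : G₀) ^ n • z))) (sig p)) atTop (𝓝 0) := by
    refine squeeze_zero (fun n => bil_nonneg (inCone_sig _) (inCone_sig _)) bound ?_
    have := tendsto_pow_atTop_nhds_zero_of_lt_one (inv_nonneg.mpr (by linarith : (0 : ℝ) ≤ μ))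
      (inv_lt_one_of_one_lt₀ hμ)
    simpa using this.const_mul (bil X (sig p) / (2 * √(qdet X)))
  have lim' := lim.sqrt
  rw [Real.sqrt_zero] at lim'
  have key := fun n : ℕ => sq_dist_le_bil (inCone_sig (toSphere ((H : G₀) ^ n • z))) hq
    (sig_trace _) (sig_trace p)
  have lA : Tendsto (fun n : ℕ => (sig (toSphere ((H : G₀) ^ n • z))).1) atTop (𝓝 (sig p).1) := by
    rw [← tendsto_sub_nhds_zero_iff]
    refine squeeze_zero_norm (fun n => Real.le_sqrt_of_sq_le ?_) lim'
    rw [Real.norm_eq_abs, sq_abs]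
    have := key n
    nlinarith [sq_nonneg ((sig (toSphere ((H : G₀) ^ n • z))).2.1 - (sig p).2.1)]
  have lB : Tendsto (fun n : ℕ => (sig (toSphere ((H : G₀) ^ n • z))).2.1) atTop
      (𝓝 (sig p).2.1) := by
    rw [← tendsto_sub_nhds_zero_iff]
    refine squeeze_zero_norm (fun n => Real.le_sqrt_of_sq_le ?_) lim'
    rw [Real.norm_eq_abs, sq_abs]
    have := key n
    nlinarith [sq_nonneg ((sig (toSphere ((H : G₀) ^ n • z))).1 - (sig p).1)]
  have e : ∀ q : OnePoint ℂ, (sig q).2.2 = 1 - (sig q).1 := fun q => by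
    have := sig_trace q; linarith
  have lC : Tendsto (fun n : ℕ => (sig (toSphere ((H : G₀) ^ n • z))).2.2) atTop
      (𝓝 (sig p).2.2) := by
    rw [e p]
    exact (lA.const_sub 1).congr fun n => (e _).symm
  exact tendsto_of_tendsto_sig mem hp (lA.prodMk_nhds (lB.prodMk_nhds lC))

/-- Two candidates solve the eigenvector equation, one from each row of `H - t`. Both vanish only if
`H` is the scalar `t`, which would give `t² = 1`. -/
lemma exists_eigenvector {H : SL(2, ℝ)} {t : ℝ} (h : t ^ 2 - (H 0 0 + H 1 1) * t + 1 = 0)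
    (ht : t ^ 2 ≠ 1) : ∃ v : ℝ × ℝ, v ≠ 0 ∧ mulv H v = t • v := by
  have hd := det_eq H
  by_cases hv : ((H 0 1, t - H 0 0) : ℝ × ℝ) = 0
  · refine ⟨(t - H 1 1, H 1 0), fun hw => ht ?_, ?_⟩
    · simp only [Prod.mk_eq_zero] at hv hw
      have h1 : H 0 0 = t := by linarith [hv.2]
      have h2 : H 1 1 = t := by linarith [hw.1]
      rw [h1, h2, hv.1] at hd
      linarith
    · simp only [mulv]
      ext
      · simp only [Prod.smul_fst, smul_eq_mul]; linear_combination -h - hd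
      · simp only [Prod.smul_snd, smul_eq_mul]; ring
  · refine ⟨_, hv, ?_⟩
    simp only [mulv]
    ext
    · simp only [Prod.smul_fst, smul_eq_mul]; ring
    · simp only [Prod.smul_snd, smul_eq_mul]; linear_combination -h - hd

lemma exists_expanding_fixed {H : SL(2, ℝ)} (h : 4 < (H 0 0 + H 1 1) ^ 2) :
    ∃ p ∈ closedPlane, ∃ μ : ℝ, 1 < μ ∧ act H (sig p) = μ • sig p := by
  have key : ∃ t : ℝ, t ^ 2 - (H 0 0 + H 1 1) * t + 1 = 0 ∧ 1 < t ^ 2 := by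
    generalize H 0 0 + H 1 1 = s at *
    have hs := Real.sq_sqrt (show 0 ≤ s ^ 2 - 4 by linarith)
    have hs' : 0 < √(s ^ 2 - 4) := Real.sqrt_pos.mpr (by linarith)
    rcases le_or_gt 0 s with h0 | h0
    · refine ⟨(s + √(s ^ 2 - 4)) / 2, by nlinarith, ?_⟩
      have : 2 < s := by nlinarith
      nlinarith
    · refine ⟨(s - √(s ^ 2 - 4)) / 2, by nlinarith, ?_⟩
      have : s < -2 := by nlinarith
      nlinarith
  obtain ⟨t, ht, ht'⟩ := key
  obtain ⟨v, hv, hv'⟩ := exists_eigenvector ht ht'.ne'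
  obtain ⟨p, hp, c, hc, e⟩ := exists_sig (inCone_sq hv)
  refine ⟨p, hp, t ^ 2, ht', ?_⟩
  have e' : sig p = c⁻¹ • sq v := by rw [e, smul_smul, inv_mul_cancel₀ hc.ne', one_smul]
  rw [e', act_smul, act_sq, hv', sq_smul, smul_comm]

/-- An expanded eigenray is null, say `sq v`, and `v` is an eigenvector of `H` of eigenvalue `t`
with `t² = μ`. The trace is `t + 1/t`, so its square is `(μ + 1)² / μ > 4`. -/
lemma trace_of_expanding {H : SL(2, ℝ)} {X : Form} {μ : ℝ} (hX : InCone X) (hμ : 1 < μ)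
    (h : act H X = μ • X) : 4 < (H 0 0 + H 1 1) ^ 2 := by
  obtain ⟨v, rfl⟩ := exists_eq_sq hX.1 hX.2.1 (qdet_eq_zero_of_eigen hμ h)
  have hv : v ≠ 0 := by rintro rfl; exact hX.2.2.2 (by simp [sq])
  have hd := det_eq H
  have hs : 0 < √μ := Real.sqrt_pos.mpr (by linarith)
  have hs2 : √μ ^ 2 = μ := Real.sq_sqrt (by linarith)
  have h1 : sq (mulv H v) = sq (√μ • v) := by rw [← act_sq, h, sq_smul, hs2]
  have h2 : ∃ t : ℝ, t ^ 2 = μ ∧ mulv H v = t • v := by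
    rcases eq_or_eq_neg_of_sq_eq_sq h1 with h | h
    · exact ⟨_, hs2, h⟩
    · exact ⟨-√μ, by rw [neg_sq, hs2], by rw [h]; ext <;> simp⟩
  obtain ⟨t, ht, e⟩ := h2
  simp only [mulv, Prod.ext_iff, Prod.smul_fst, Prod.smul_snd, smul_eq_mul] at e
  have e3 : t ^ 2 - (H 0 0 + H 1 1) * t + 1 = 0 := by
    by_contra hne
    apply hv
    ext
    · have : (t ^ 2 - (H 0 0 + H 1 1) * t + 1) * v.1 = 0 := by
        linear_combination (H 1 1 - t) * e.1 - H 0 1 * e.2 - v.1 * hd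
      simpa [hne] using this
    · have : (t ^ 2 - (H 0 0 + H 1 1) * t + 1) * v.2 = 0 := by
        linear_combination (H 0 0 - t) * e.2 - H 1 0 * e.1 - v.2 * hd
      simpa [hne] using this
  have e4 : (H 0 0 + H 1 1) ^ 2 * μ = (μ + 1) ^ 2 := by
    have : (H 0 0 + H 1 1) * t = μ + 1 := by linarith
    rw [← this, mul_pow, ht]
  nlinarith [sq_pos_of_pos (sub_pos.mpr hμ)]

lemma smul_eq_self_iff (H : SL(2, ℝ)) {p : OnePoint ℂ} (hp : p ∈ closedPlane) :
    (H : G₀) • p = p ↔ ∃ μ : ℝ, act H (sig p) = μ • sig p := by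
  obtain ⟨c, hc, e⟩ := exists_sig_smul H p
  constructor
  · intro h
    exact ⟨c, by rw [e, h]⟩
  · rintro ⟨μ, h⟩
    rw [e] at h
    have t1 := sig_trace ((H : G₀) • p)
    have t2 := sig_trace p
    have hcμ : c = μ := by
      have h1 := congrArg (fun X : Form => X.1 + X.2.2) h
      simpa only [Prod.smul_fst, Prod.smul_snd, smul_eq_mul, ← mul_add, t1, t2, mul_one] using h1
    rw [← hcμ] at h
    exact sig_injOn (smul_mem_closedPlane H hp) hp (smul_right_injective _ hc.ne' h)

/-- A hyperbolic element has an expanded eigenray, to which all its forward orbits converge;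
uniqueness of limits identifies it with an attracting `p`. -/
lemma isAttracting_iff {H : SL(2, ℝ)} {p : OnePoint ℂ} {μ : ℝ} (hp : p ∈ closedPlane)
    (h : act H (sig p) = μ • sig p) : IsAttracting (H : G₀) p ↔ 1 < μ := by
  constructor
  · rintro ⟨h1, h2⟩
    rw [isHyperbolic_coe_iff] at h1
    obtain ⟨q, hq, ν, hν, e⟩ := exists_expanding_fixed h1
    have : p = q := tendsto_nhds_unique (h2 I) (tendsto_pow_smul hq e hν I)
    subst this
    rw [h] at e
    have t := sig_trace p
    have h1 := congrArg (fun X : Form => X.1 + X.2.2) e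
    simp only [Prod.smul_fst, Prod.smul_snd, smul_eq_mul, ← mul_add, t, mul_one] at h1
    rwa [h1]
  · intro hμ
    exact ⟨(isHyperbolic_coe_iff H).mpr (trace_of_expanding (inCone_sig p) hμ h),
      tendsto_pow_smul hp h hμ⟩

lemma isNonattractingFixedPoint_iff (H : SL(2, ℝ)) {p : OnePoint ℂ} (hp : p ∈ closedPlane) :
    IsNonattractingFixedPoint (H : G₀) p ↔ NonexpandingEigen H (sig p) := by
  constructor
  · rintro ⟨h1, h2⟩
    obtain ⟨μ, h⟩ := (smul_eq_self_iff H hp).mp h1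
    rw [isAttracting_iff hp h, not_lt] at h2
    exact ⟨μ, h2, h⟩
  · rintro ⟨μ, hμ, h⟩
    refine ⟨(smul_eq_self_iff H hp).mpr ⟨μ, h⟩, ?_⟩
    rwa [isAttracting_iff hp h, not_lt]

lemma NonexpandingEigen.smul {H : SL(2, ℝ)} {X : Form} (h : NonexpandingEigen H X) (c : ℝ) :
    NonexpandingEigen H (c • X) := by
  obtain ⟨μ, hμ, h⟩ := h
  exact ⟨μ, hμ, by rw [act_smul, h, smul_comm]⟩

/-! ### Geodesic lines -/

/-- The coordinate of `X` transverse to the line joining the columns of `M`. -/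
def coord (M : SL(2, ℝ)) (X : Form) : ℝ := (act M⁻¹ X).2.1

/-- The columns of `M` span the endpoints of `l`. -/
def IsFrame (M : SL(2, ℝ)) (l : Set ℍ) : Prop := ∀ z, z ∈ l ↔ coord M (pt z) = 0

/-- The rotation by a quarter turn. -/
def quarterTurn : SL(2, ℝ) := ⟨!![0, -1; 1, 0], by simp [Matrix.det_fin_two_of]⟩

lemma col_mul_quarterTurn_zero (M : SL(2, ℝ)) : col (M * quarterTurn) 0 = col M 1 := by
  simp only [col, mul_entry]; simp [quarterTurn]

lemma coord_mul_quarterTurn (M : SL(2, ℝ)) (X : Form) :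
    coord (M * quarterTurn) X = -coord M X := by
  obtain ⟨h1, h2, h3, h4⟩ := inv_entries quarterTurn
  rw [coord, mul_inv_rev, act_mul, coord]
  simp only [act, h1, h2, h3, h4]
  simp [quarterTurn]

/-- The quarter turn exchanges the endpoint rays and the two sides. It reduces statements about all
endpoints to the first column, and makes either side the positive one. -/
lemma IsFrame.mul_quarterTurn {M : SL(2, ℝ)} {l : Set ℍ} (h : IsFrame M l) :
    IsFrame (M * quarterTurn) l := fun z => by
  rw [h z, coord_mul_quarterTurn, neg_eq_zero]

lemma coord_add (M : SL(2, ℝ)) (X Y : Form) : coord M (X + Y) = coord M X + coord M Y := by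
  simp [coord, act_add]

lemma coord_smul (M : SL(2, ℝ)) (c : ℝ) (X : Form) : coord M (c • X) = c * coord M X := by
  simp [coord, act_smul]

lemma coord_act (M : SL(2, ℝ)) (X : Form) : coord M (act M X) = X.2.1 := by
  rw [coord, act_inv_act]

lemma continuous_coord (M : SL(2, ℝ)) : Continuous (coord M) := by
  unfold coord act
  fun_prop

lemma coord_sq_col_zero (M : SL(2, ℝ)) : coord M (sq (col M 0)) = 0 := by
  rw [← mulv_e0, ← act_sq, coord_act]; simp [sq]

lemma coord_sq_col_one (M : SL(2, ℝ)) : coord M (sq (col M 1)) = 0 := by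
  rw [← mulv_e1, ← act_sq, coord_act]; simp [sq]

lemma coord_sq_col (M : SL(2, ℝ)) (i : Fin 2) : coord M (sq (col M i)) = 0 := by
  fin_cases i
  · exact coord_sq_col_zero M
  · exact coord_sq_col_one M

lemma col_ne_zero (M : SL(2, ℝ)) (i : Fin 2) : col M i ≠ 0 := by
  have h := det2_col M
  intro h0
  fin_cases i
  · have h0 : col M 0 = 0 := h0
    simp [h0, det2] at h
  · have h0 : col M 1 = 0 := h0
    simp [h0, det2] at h

/-- A null matrix lies in the cone or in its opposite, and the opposite pairs nonpositively with the
cone. -/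
lemma nonneg_of_null {U P : Form} (hU : qdet U = 0) (hP : InCone P) (h : 0 < bil U P) :
    0 ≤ U.1 ∧ 0 ≤ U.2.2 := by
  have hprod : 0 ≤ U.1 * U.2.2 := by simp only [qdet] at hU; nlinarith [sq_nonneg U.2.1]
  by_contra hcon
  have hneg : U.1 ≤ 0 ∧ U.2.2 ≤ 0 := by
    by_contra! h'
    apply hcon
    rcases lt_or_ge U.1 0 with h1 | h1
    · have h2 := h' h1.le
      nlinarith
    · refine ⟨h1, ?_⟩
      rcases h1.eq_or_lt with h2 | h2
      · exact (h' h2.symm.le).le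
      · exact nonneg_of_mul_nonneg_right hprod h2
  have hc : InCone (-U) := by
    refine ⟨by simpa using hneg.1, by simpa using hneg.2, ?_, ?_⟩
    · have : qdet (-U) = qdet U := by simp [qdet]
      rw [this, hU]
    · intro h0
      rw [neg_eq_zero] at h0
      simp [h0, bil] at h
  have h1 := bil_nonneg hc hP
  have h2 : bil (-U) P = -bil U P := by simp only [bil, Prod.fst_neg, Prod.snd_neg]; ring
  linarith

lemma exists_isFrame {l : Set ℍ} (hl : IsGeodesicLine l) : ∃ M, IsFrame M l := by
  obtain ⟨γ, hγ, rfl⟩ := hl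
  have hb : ∀ s t : ℝ, bil (pt (γ s)) (pt (γ t)) = Real.exp (s - t) + Real.exp (t - s) := by
    intro s t
    have := cosh_dist_eq (γ s) (γ t)
    rw [hγ.dist_eq, Real.dist_eq, Real.cosh_abs, Real.cosh_eq, neg_sub] at this
    linarith
  set a := Real.exp 1 with ha
  have ha1 : 1 < a := Real.one_lt_exp_iff.mpr one_pos
  have ha0 : 0 < a := by linarith
  have hia : Real.exp (-1) = a⁻¹ := Real.exp_neg 1
  set P := pt (γ 0) with hP
  set Q := pt (γ 1) with hQ
  have hPQ : bil P Q = a + a⁻¹ := by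
    rw [hP, hQ, hb, zero_sub, sub_zero, hia, ← ha, add_comm]
  have qP : qdet P = 1 := qdet_pt _
  have qQ : qdet Q = 1 := qdet_pt _
  have hden : a ^ 2 - 1 ≠ 0 := by nlinarith
  -- A unit-speed geodesic in the hyperboloid is `exp t • U + exp (-t) • W` with `U, W` null. These
  -- values solve `P = U + W` and `Q = a U + a⁻¹ W`, the points at times `0` and `1`.
  set U : Form := (a / (a ^ 2 - 1)) • (Q + (-a⁻¹) • P) with hU
  set W : Form := (a / (a ^ 2 - 1)) • (a • P + (-1 : ℝ) • Q) with hW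
  have qadd : ∀ (s t : ℝ) (X Y : Form), qdet (s • X + t • Y) =
      s ^ 2 * qdet X + t ^ 2 * qdet Y + s * t * bil X Y := by
    intro s t X Y
    simp only [qdet, bil, Prod.fst_add, Prod.snd_add, Prod.smul_fst, Prod.smul_snd, smul_eq_mul]
    ring
  have qU : qdet U = 0 := by
    have : Q + (-a⁻¹) • P = (1 : ℝ) • Q + (-a⁻¹) • P := by rw [one_smul]
    rw [hU, qdet_smul, this, qadd, qP, qQ, bil_comm, hPQ]
    field_simp; ring
  have qW : qdet W = 0 := by
    rw [hW, qdet_smul, qadd, qP, qQ, hPQ]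
    field_simp; ring
  have bP : ∀ X, bil X U = (a / (a ^ 2 - 1)) * (bil X Q - a⁻¹ * bil X P) := by
    intro X; rw [hU, bil_smul_right, bil_add_right, bil_smul_right]; ring
  have bQ : ∀ X, bil X W = (a / (a ^ 2 - 1)) * (a * bil X P - bil X Q) := by
    intro X; rw [hW, bil_smul_right, bil_add_right, bil_smul_right, bil_smul_right]; ring
  have bPP : bil P P = 2 := by rw [bil_self, qP, mul_one]
  have bQQ : bil Q Q = 2 := by rw [bil_self, qQ, mul_one]
  have bPU : bil U P = 1 := by
    rw [bil_comm, bP, hPQ, bPP]; field_simp; ring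
  have bQU : bil U Q = a⁻¹ := by
    rw [bil_comm, bP, bil_comm Q P, hPQ, bQQ]; field_simp; ring
  have bPW : bil W P = 1 := by
    rw [bil_comm, bQ, hPQ, bPP]; field_simp; ring
  have bUW : bil U W = 1 := by
    rw [bQ, bPU, bQU]; field_simp
  obtain ⟨uA, uC⟩ := nonneg_of_null qU (inCone_pt _) (by rw [← hP, bPU]; exact one_pos)
  obtain ⟨wA, wC⟩ := nonneg_of_null qW (inCone_pt _) (by rw [← hP, bPW]; exact one_pos)
  obtain ⟨u, hu⟩ := exists_eq_sq uA uC qU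
  obtain ⟨w, hw⟩ := exists_eq_sq wA wC qW
  -- The vector `w` is known only up to sign, which is used to orient the basis.
  have huw : ∃ w', W = sq w' ∧ det2 u w' = 1 := by
    rw [hu, hw, bil_sq] at bUW
    rcases mul_self_eq_one_iff.mp ((pow_two _).symm.trans bUW) with h | h
    · exact ⟨w, hw, h⟩
    · refine ⟨-w, by rw [hw]; ext <;> simp [sq], ?_⟩
      have : det2 u (-w) = -det2 u w := by simp only [det2, Prod.fst_neg, Prod.snd_neg]; ring
      rw [this, h, neg_neg]
  obtain ⟨w', hw', hdet⟩ := huw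
  obtain ⟨M, hM0, hM1⟩ := exists_col hdet
  have hC : ∀ X, (act M⁻¹ X).2.2 = bil X U := by
    intro X
    rw [hu, ← hM0, ← mulv_e0, ← bil_act M⁻¹, ← act_sq, act_inv_act]
    simp [bil, sq]
  have hA : ∀ X, (act M⁻¹ X).1 = bil X W := by
    intro X
    rw [hw', ← hM1, ← mulv_e1, ← bil_act M⁻¹, ← act_sq, act_inv_act]
    simp [bil, sq]
  have key : ∀ t : ℝ, act M⁻¹ (pt (γ t)) = (Real.exp t, 0, Real.exp (-t)) := by
    intro t
    have e1 : (act M⁻¹ (pt (γ t))).1 = Real.exp t := by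
      rw [hA, bQ, hP, hQ, hb, hb, sub_zero, zero_sub, Real.exp_sub, Real.exp_sub, ← ha,
        Real.exp_neg]
      have := Real.exp_pos t
      field_simp; ring
    have e2 : (act M⁻¹ (pt (γ t))).2.2 = Real.exp (-t) := by
      rw [hC, bP, hP, hQ, hb, hb, sub_zero, zero_sub, Real.exp_sub, Real.exp_sub, ← ha,
        Real.exp_neg]
      have := Real.exp_pos t
      field_simp; ring
    have e3 : (act M⁻¹ (pt (γ t))).2.1 = 0 := by
      have := qdet_act M⁻¹ (pt (γ t))
      rw [qdet_pt] at this
      simp only [qdet, e1, e2, ← Real.exp_add] at this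
      simpa using this
    ext <;> assumption
  refine ⟨M, fun z => ⟨?_, fun h => ?_⟩⟩
  · rintro ⟨t, rfl⟩
    simp [coord, key]
  · have hc := (inCone_pt z).act M⁻¹
    have hq := qdet_act M⁻¹ (pt z)
    rw [qdet_pt] at hq
    have h : (act M⁻¹ (pt z)).2.1 = 0 := h
    simp only [qdet, h] at hq
    have hpos : 0 < (act M⁻¹ (pt z)).1 := by
      refine lt_of_le_of_ne hc.1 fun e => ?_
      rw [← e] at hq; simp at hq
    -- A diagonal matrix in the cone of determinant one is `(e ^ t, 0, e ^ (-t))`, and the first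
    -- entry gives `t`.
    refine ⟨Real.log (act M⁻¹ (pt z)).1, pt_injective ?_⟩
    suffices e : act M⁻¹ (pt (γ (Real.log (act M⁻¹ (pt z)).1))) = act M⁻¹ (pt z) by
      rw [← act_act_inv M (pt (γ _)), e, act_act_inv]
    rw [key, Real.exp_neg, Real.exp_log hpos]
    ext
    · rfl
    · exact h.symm
    · simp only
      field_simp
      linarith

/-! ### The closure of a line, its endpoints and its sides -/

lemma isClosed_coord_eq (M : SL(2, ℝ)) : IsClosed {p | p ∈ closedPlane ∧ coord M (sig p) = 0} :=
  isClosed_closedPlane.inter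
    (isClosed_singleton.preimage ((continuous_coord M).comp continuous_sig))

lemma coord_sig_toSphere_eq_zero (M : SL(2, ℝ)) (z : ℍ) :
    coord M (sig (toSphere z)) = 0 ↔ coord M (pt z) = 0 := by
  have := one_add_normSq_pos z
  have h := z.im_pos
  have : z.im / (1 + Complex.normSq z) ≠ 0 := by positivity
  rw [sig_toSphere, coord_smul, mul_eq_zero, or_iff_right this]

lemma IsFrame.mem_clo_iff {M : SL(2, ℝ)} {l : Set ℍ} (h : IsFrame M l) {p : OnePoint ℂ} :
    p ∈ clo l ↔ p ∈ closedPlane ∧ coord M (sig p) = 0 := by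
  constructor
  · intro hp
    refine (closure_minimal ?_ (isClosed_coord_eq M)) hp
    rintro _ ⟨z, hz, rfl⟩
    exact ⟨toSphere_mem_closedPlane z, (coord_sig_toSphere_eq_zero M z).mpr ((h z).mp hz)⟩
  · rintro ⟨hp, h0⟩
    -- A point `z` of the line is chosen as base point. In the Klein model the open segment from
    -- `sig p` to `sig z` has positive determinant and zero coordinate, so it consists of points of
    -- the line, and these tend to `p`.
    have hZ : InCone (act M (1, 0, 1)) :=
      InCone.act ⟨zero_le_one, zero_le_one, by simp [qdet], by simp⟩ M
    have hqZ : qdet (act M (1, 0, 1)) = 1 := by rw [qdet_act]; simp [qdet]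
    obtain ⟨z, hz⟩ := exists_pt hZ hqZ
    have hz0 : coord M (sig (toSphere z)) = 0 := by
      rw [coord_sig_toSphere_eq_zero, hz, coord_act]
    set V := sig p with hV
    set Z := sig (toSphere z) with hZdef
    have hqZ : 0 < qdet Z := (qdet_sig_pos_iff (toSphere_mem_closedPlane z)).mpr ⟨z, rfl⟩
    have hY : ∀ t : ℝ, 0 < t → t < 1 → ∃ y ∈ l, sig (toSphere y) = (1 - t) • V + t • Z := by
      intro t ht ht'
      have hq : 0 < qdet ((1 - t) • V + t • Z) := by
        have : qdet ((1 - t) • V + t • Z) =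
            (1 - t) ^ 2 * qdet V + t ^ 2 * qdet Z + (1 - t) * t * bil V Z := by
          simp only [qdet, bil, Prod.fst_add, Prod.snd_add, Prod.smul_fst, Prod.smul_snd,
            smul_eq_mul]
          ring
        rw [this]
        have h1 := (inCone_sig p).2.2.1
        have h2 := bil_nonneg (inCone_sig p) (inCone_sig (toSphere z))
        have h3 : 0 < 1 - t := by linarith
        positivity
      obtain ⟨q, hq1, hq2⟩ := exists_sig_eq (X := (1 - t) • V + t • Z)
        ⟨add_nonneg (mul_nonneg (by linarith) (inCone_sig p).1)
          (mul_nonneg ht.le (inCone_sig (toSphere z)).1),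
        add_nonneg (mul_nonneg (by linarith) (inCone_sig p).2.1)
          (mul_nonneg ht.le (inCone_sig (toSphere z)).2.1), hq.le, fun h0 => by rw [h0] at hq; simp [qdet] at hq⟩ (by
          have h1 := sig_trace p
          have h2 := sig_trace (toSphere z)
          simp only [Prod.fst_add, Prod.snd_add, Prod.smul_fst, Prod.smul_snd, smul_eq_mul]
          linear_combination (1 - t) * h1 + t * h2)
      obtain ⟨y, rfl⟩ := (qdet_sig_pos_iff hq1).mp (by rwa [hq2])
      refine ⟨y, ?_, hq2⟩
      rw [h y, ← coord_sig_toSphere_eq_zero, hq2, coord_add, coord_smul, coord_smul, h0, hz0]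
      simp
    have hY' : ∀ t : Ioo (0 : ℝ) 1, ∃ y ∈ l, sig (toSphere y) = (1 - t.1) • V + t.1 • Z :=
      fun t => hY t t.2.1 t.2.2
    choose y hyl hy using hY'
    have lim : Tendsto (fun t : Ioo (0 : ℝ) 1 => toSphere (y t)) (comap Subtype.val (𝓝 0)) (𝓝 p) := by
      refine tendsto_of_tendsto_sig (fun t => toSphere_mem_closedPlane _) hp ?_
      simp only [hy]
      have hc : Continuous fun t : ℝ => (1 - t) • V + t • Z := by fun_prop
      have h0 := hc.tendsto 0
      rw [sub_zero, one_smul, zero_smul, add_zero] at h0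
      exact h0.comp tendsto_comap
    have : (comap (Subtype.val : Ioo (0 : ℝ) 1 → ℝ) (𝓝 0)).NeBot := by
      rw [← mem_closure_iff_comap_neBot, closure_Ioo zero_ne_one]
      exact ⟨le_rfl, zero_le_one⟩
    exact mem_closure_of_tendsto lim (Eventually.of_forall fun t => ⟨y t, hyl t, rfl⟩)

lemma IsFrame.mem_endpoints_iff {M : SL(2, ℝ)} {l : Set ℍ} (h : IsFrame M l) {p : OnePoint ℂ} :
    p ∈ endpoints l ↔ p ∈ closedPlane ∧ ∃ i, ∃ c : ℝ, 0 < c ∧ sig p = c • sq (col M i) := by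
  rw [endpoints, mem_inter_iff, h.mem_clo_iff, mem_idealBoundary]
  constructor
  · rintro ⟨⟨hp, h0⟩, -, hq⟩
    refine ⟨hp, ?_⟩
    have hc := (inCone_sig p).act M⁻¹
    rw [← qdet_act M⁻¹] at hq
    have h0 : (act M⁻¹ (sig p)).2.1 = 0 := h0
    have e := act_eq_of_coord_eq_zero M h0
    rw [act_act_inv] at e
    simp only [qdet, h0] at hq
    have hAC : (act M⁻¹ (sig p)).1 * (act M⁻¹ (sig p)).2.2 = 0 := by linarith
    have ht := hc.trace_pos
    rcases mul_eq_zero.mp hAC with h1 | h1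
    · refine ⟨1, (act M⁻¹ (sig p)).2.2, by linarith, ?_⟩
      rw [h1, zero_smul, zero_add] at e
      exact e
    · refine ⟨0, (act M⁻¹ (sig p)).1, by linarith, ?_⟩
      rw [h1, zero_smul, add_zero] at e
      exact e
  · rintro ⟨hp, i, c, hc, e⟩
    refine ⟨⟨hp, ?_⟩, hp, ?_⟩
    · rw [e, coord_smul, coord_sq_col, mul_zero]
    · rw [e, qdet_smul, qdet_sq, mul_zero]

/-- In the Klein model this set is the intersection of a closed disc with an open half-plane, hence
convex. -/
lemma isPreconnected_coord_pos (M : SL(2, ℝ)) :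
    IsPreconnected {p | p ∈ closedPlane ∧ 0 < coord M (sig p)} := by
  have e : {p | p ∈ closedPlane ∧ 0 < coord M (sig p)} =
      Subtype.val '' {p : closedPlane | 0 < coord M (sig p)} := by
    ext p
    constructor
    · rintro ⟨hp, h⟩
      exact ⟨⟨p, hp⟩, h, rfl⟩
    · rintro ⟨q, h, rfl⟩
      exact ⟨q.2, h⟩
  rw [e]
  refine IsPreconnected.image ?_ _ continuous_subtype_val.continuousOn
  rw [← isClosedEmbedding_sig.isInducing.isPreconnected_image]
  have e2 : (fun p : closedPlane => sig p) '' {p : closedPlane | 0 < coord M (sig p)} =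
      {X : Form | 0 ≤ X.1 ∧ 0 ≤ X.2.2 ∧ 0 ≤ qdet X ∧ X.1 + X.2.2 = 1 ∧ 0 < coord M X} := by
    ext X
    constructor
    · rintro ⟨p, h, rfl⟩
      have hc := inCone_sig p
      exact ⟨hc.1, hc.2.1, hc.2.2.1, sig_trace _, h⟩
    · rintro ⟨h1, h2, h3, h4, h5⟩
      obtain ⟨p, hp, rfl⟩ := exists_sig_eq ⟨h1, h2, h3, fun h => by simp [h] at h4⟩ h4
      exact ⟨⟨p, hp⟩, h5, rfl⟩
  rw [e2]
  refine Convex.isPreconnected ?_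
  rintro X ⟨h1, h2, h3, h4, h5⟩ Y ⟨k1, k2, k3, k4, k5⟩ s t hs ht hst
  have hb : 0 ≤ bil X Y := bil_nonneg ⟨h1, h2, h3, fun h => by simp [h] at h4⟩
    ⟨k1, k2, k3, fun h => by simp [h] at k4⟩
  refine ⟨add_nonneg (mul_nonneg hs h1) (mul_nonneg ht k1),
    add_nonneg (mul_nonneg hs h2) (mul_nonneg ht k2), ?_, ?_, ?_⟩
  · have : qdet (s • X + t • Y) = s ^ 2 * qdet X + t ^ 2 * qdet Y + s * t * bil X Y := by
      simp only [qdet, bil, Prod.fst_add, Prod.snd_add, Prod.smul_fst, Prod.smul_snd, smul_eq_mul]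
      ring
    rw [this]; positivity
  · simp only [Prod.fst_add, Prod.snd_add, Prod.smul_fst, Prod.smul_snd, smul_eq_mul]
    linear_combination s * h4 + t * k4 + hst
  · rw [coord_add, coord_smul, coord_smul]
    rcases hs.eq_or_lt with h | h
    · have : t = 1 := by linarith
      rw [← h, this]; linarith
    · have := mul_pos h h5
      have := mul_nonneg ht k5.le
      linarith

lemma IsFrame.exists_of_isSide {M₀ : SL(2, ℝ)} {l : Set ℍ} (h₀ : IsFrame M₀ l)
    {S : Set (OnePoint ℂ)} (hS : IsSide l S) :
    ∃ M, IsFrame M l ∧ S = {p | p ∈ closedPlane ∧ 0 < coord M (sig p)} := by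
  obtain ⟨p, ⟨hp, hpl⟩, rfl⟩ := hS
  obtain ⟨M, h, hpos⟩ : ∃ M, IsFrame M l ∧ 0 < coord M (sig p) := by
    have hne : coord M₀ (sig p) ≠ 0 := fun e => hpl (h₀.mem_clo_iff.mpr ⟨hp, e⟩)
    rcases lt_or_gt_of_ne hne with h1 | h1
    · exact ⟨_, h₀.mul_quarterTurn, by rw [coord_mul_quarterTurn]; linarith⟩
    · exact ⟨M₀, h₀, h1⟩
  refine ⟨M, h, Subset.antisymm ?_ ?_⟩
  · intro q hq
    have hsub := connectedComponentIn_subset (closedPlane \ clo l) p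
    refine ⟨(hsub hq).1, ?_⟩
    -- By the intermediate value property, `coord M` cannot change sign on the component without
    -- vanishing, and it vanishes only on the closed line.
    have hpre := (isPreconnected_connectedComponentIn (F := closedPlane \ clo l) (x := p)).image
      _ ((continuous_coord M).comp continuous_sig).continuousOn
    by_contra! hle
    have h0 : (0 : ℝ) ∈ (coord M ∘ sig) '' connectedComponentIn (closedPlane \ clo l) p :=
      hpre.ordConnected.out (mem_image_of_mem _ hq)
        (mem_image_of_mem _ (mem_connectedComponentIn ⟨hp, hpl⟩)) ⟨hle, hpos.le⟩
    obtain ⟨r, hr, hr0⟩ := h0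
    exact (hsub hr).2 (h.mem_clo_iff.mpr ⟨(hsub hr).1, hr0⟩)
  · refine (isPreconnected_coord_pos M).subset_connectedComponentIn ⟨hp, hpos⟩ ?_
    rintro q ⟨hq, hq'⟩
    exact ⟨hq, fun hc => hq'.ne' (h.mem_clo_iff.mp hc).2⟩

/-! ### Crooked planes and half-spaces -/

lemma IsFrame.mem_rightCrookedPlane_iff {M : SL(2, ℝ)} {l : Set ℍ} (h : IsFrame M l)
    (H : SL(2, ℝ)) : (H : G₀) ∈ rightCrookedPlane l ↔
      ∃ X, InCone X ∧ coord M X = 0 ∧ NonexpandingEigen H X := by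
  constructor
  · rintro ⟨p, hp, hn⟩
    obtain ⟨hp, h0⟩ := h.mem_clo_iff.mp hp
    exact ⟨sig p, inCone_sig p, h0, (isNonattractingFixedPoint_iff H hp).mp hn⟩
  · rintro ⟨X, hX, h0, hn⟩
    obtain ⟨p, hp, c, hc, rfl⟩ := exists_sig hX
    rw [coord_smul, mul_eq_zero, or_iff_right hc.ne'] at h0
    refine ⟨p, h.mem_clo_iff.mpr ⟨hp, h0⟩, (isNonattractingFixedPoint_iff H hp).mpr ?_⟩
    have := hn.smul c⁻¹
    rwa [smul_smul, inv_mul_cancel₀ hc.ne', one_smul] at this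

lemma mem_rightHalfSpace {M H : SL(2, ℝ)} {X : Form} (hX : InCone X) (h0 : 0 < coord M X)
    (hn : NonexpandingEigen H X) (h1 : (H : G₀) ≠ 1) :
    (H : G₀) ∈ rightHalfSpace {p | p ∈ closedPlane ∧ 0 < coord M (sig p)} := by
  obtain ⟨p, hp, c, hc, rfl⟩ := exists_sig hX
  rw [coord_smul] at h0
  refine ⟨h1, p, ⟨hp, pos_of_mul_pos_right h0 hc.le⟩, (isNonattractingFixedPoint_iff H hp).mpr ?_⟩
  have := hn.smul c⁻¹
  rwa [smul_smul, inv_mul_cancel₀ hc.ne', one_smul] at this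

/-! ### The closure of a half-space -/

lemma continuous_act : Continuous fun q : SL(2, ℝ) × Form => act q.1 q.2 := by
  have h : ∀ i j : Fin 2, Continuous fun q : SL(2, ℝ) × Form => q.1 i j := fun i j =>
    (continuous_subtype_val.comp continuous_fst).matrix_elem i j
  have h00 := h 0 0
  have h01 := h 0 1
  have h10 := h 1 0
  have h11 := h 1 1
  unfold act
  fun_prop

lemma continuous_coe_PSL : Continuous ((↑) : SL(2, ℝ) → G₀) := continuous_quot_mk

/-- Eigenvectors can be normalised to trace one and eigenvalues lie in `[0, 1]`. The set is
therefore the projection of a closed set along a compact factor. -/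
lemma isClosed_nonexpanding (M : SL(2, ℝ)) : IsClosed {H : SL(2, ℝ) |
    ∃ X, InCone X ∧ 0 ≤ coord M X ∧ NonexpandingEigen H X} := by
  set K : Set (Form × ℝ) := {q | (0 ≤ q.1.1 ∧ 0 ≤ q.1.2.2 ∧ 0 ≤ qdet q.1 ∧ q.1.1 + q.1.2.2 = 1 ∧
    0 ≤ coord M q.1) ∧ 0 ≤ q.2 ∧ q.2 ≤ 1} with hK
  have cq : Continuous qdet := by unfold qdet; fun_prop
  have cc := continuous_coord M
  have hKc : IsClosed K := by
    have c1 : Continuous fun q : Form × ℝ => q.1.1 := by fun_prop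
    have c2 : Continuous fun q : Form × ℝ => q.1.2.2 := by fun_prop
    have c3 : Continuous fun q : Form × ℝ => qdet q.1 := by fun_prop
    have c4 : Continuous fun q : Form × ℝ => coord M q.1 := by fun_prop
    exact ((isClosed_le continuous_const c1).inter ((isClosed_le continuous_const c2).inter
      ((isClosed_le continuous_const c3).inter ((isClosed_eq (c1.add c2) continuous_const).inter
      (isClosed_le continuous_const c4))))).inter
      ((isClosed_le continuous_const continuous_snd).inter
        (isClosed_le continuous_snd continuous_const))
  have hKcomp : IsCompact K := by
    refine IsCompact.of_isClosed_subset (isCompact_Icc (a := ((0, -1, 0), 0))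
      (b := (((1, 1, 1), 1) : Form × ℝ))) hKc ?_
    rintro ⟨⟨A, B, C⟩, μ⟩ ⟨⟨h1, h2, h3, h4, -⟩, h5, h6⟩
    simp only [qdet] at *
    have hB : B ^ 2 ≤ 1 := by nlinarith
    have hB' := abs_le_one_iff_mul_self_le_one.mpr (by nlinarith : B * B ≤ 1)
    rw [abs_le] at hB'
    exact ⟨⟨⟨h1, hB'.1, h2⟩, h5⟩, ⟨⟨by simp only; linarith, hB'.2, by simp only; linarith⟩, h6⟩⟩
  have : CompactSpace K := isCompact_iff_compactSpace.mp hKcomp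
  have hcl : IsClosed {q : SL(2, ℝ) × K | act q.1 q.2.1.1 = q.2.1.2 • q.2.1.1} := by
    refine isClosed_eq ?_ (by fun_prop)
    exact continuous_act.comp (by fun_prop : Continuous fun q : SL(2, ℝ) × K => (q.1, q.2.1.1))
  have := isClosedMap_fst_of_compactSpace _ hcl
  convert this using 1
  ext H
  constructor
  · rintro ⟨X, hX, h0, hn⟩
    have ht := hX.trace_pos
    obtain ⟨μ, hμ, e⟩ := hn.smul (X.1 + X.2.2)⁻¹
    have hX' := hX.smul (inv_pos.mpr ht)
    refine ⟨(H, ⟨(_, μ), ⟨hX'.1, hX'.2.1, hX'.2.2.1, ?_, ?_⟩, (pos_of_eigen hX' e).le, hμ⟩), e, rfl⟩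
    · simp only [Prod.smul_fst, Prod.smul_snd, smul_eq_mul]
      field_simp
    · simp only [coord_smul]; positivity
  · rintro ⟨⟨H', ⟨⟨X, μ⟩, ⟨h1, h2, h3, h4, h5⟩, h6, h7⟩⟩, e, rfl⟩
    exact ⟨X, ⟨h1, h2, h3, fun h => by simp [h] at h4⟩, h5, μ, h7, e⟩

/-- The hyperbolic translations along the geodesic from `-1` to `1`. -/
noncomputable def boost (s : ℝ) : SL(2, ℝ) :=
  ⟨!![Real.cosh s, Real.sinh s; Real.sinh s, Real.cosh s], by
    rw [Matrix.det_fin_two_of]; linarith [Real.cosh_sq s]⟩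

lemma boost_entries (s : ℝ) : boost s 0 0 = Real.cosh s ∧ boost s 0 1 = Real.sinh s ∧
    boost s 1 0 = Real.sinh s ∧ boost s 1 1 = Real.cosh s := by
  simp [boost]

lemma continuous_boost : Continuous boost := by
  refine Continuous.subtype_mk ?_ _
  refine continuous_matrix fun i j => ?_
  fin_cases i <;> fin_cases j <;> simp <;> fun_prop

lemma boost_zero : boost 0 = 1 := by
  obtain ⟨h1, h2, h3, h4⟩ := boost_entries 0
  ext i j
  fin_cases i <;> fin_cases j <;> simp [h1, h2, h3, h4]

/-- The hyperbolic translations along a perpendicular to the line of `M`. -/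
noncomputable def push (M : SL(2, ℝ)) (s : ℝ) : SL(2, ℝ) := M * boost s * M⁻¹

lemma continuous_push (M : SL(2, ℝ)) : Continuous (push M) :=
  (continuous_const.mul continuous_boost).mul continuous_const

lemma push_zero (M : SL(2, ℝ)) : push M 0 = 1 := by
  rw [push, boost_zero, mul_one, mul_inv_cancel]

lemma act_push (M : SL(2, ℝ)) (s : ℝ) :
    act (push M s) (act M (sq (1, 1))) = Real.exp s ^ 2 • act M (sq (1, 1)) := by
  obtain ⟨h1, h2, h3, h4⟩ := boost_entries s
  rw [push, act_mul, act_mul, act_inv_act, ← act_smul, ← sq_smul, act_sq]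
  congr 2
  rw [← Real.cosh_add_sinh, mulv, h1, h2, h3, h4]
  ext
  · simp
  · simp [add_comm]

/-- Translating towards the positive side moves the closed half-plane into the open one, by a
positive multiple of the trace. -/
lemma coord_push_pos {M : SL(2, ℝ)} {X : Form} (hX : InCone X) (h0 : 0 ≤ coord M X) {s : ℝ}
    (hs : 0 < s) : 0 < coord M (act (push M s) X) := by
  have hc := (hX.act M⁻¹).trace_pos
  rw [push, act_mul, act_mul, coord_act]
  have h0 : 0 ≤ (act M⁻¹ X).2.1 := h0
  generalize act M⁻¹ X = Y at *
  have h1 := Real.sinh_pos_iff.mpr hs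
  have h2 := Real.cosh_pos s
  obtain ⟨k1, k2, k3, k4⟩ := boost_entries s
  have e : (act (boost s) Y).2.1 = Real.cosh s * Real.sinh s * (Y.1 + Y.2.2) +
      (Real.cosh s ^ 2 + Real.sinh s ^ 2) * Y.2.1 := by
    simp only [act, k1, k2, k3, k4]; ring
  rw [e]
  positivity

/-- The right-hand condition is closed and invariant under `H ↦ -H`, so it descends to a closed set
of `G₀`. Conversely, a nontrivial element with a fixed point on the boundary line is a limit of its
conjugates by small translations into the positive side. -/
lemma mem_closure_rightHalfSpace_iff (M H : SL(2, ℝ)) :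
    (H : G₀) ∈ closure (rightHalfSpace {p | p ∈ closedPlane ∧ 0 < coord M (sig p)}) ↔
      ∃ X, InCone X ∧ 0 ≤ coord M X ∧ NonexpandingEigen H X := by
  set S : Set (OnePoint ℂ) := {p | p ∈ closedPlane ∧ 0 < coord M (sig p)} with hS
  constructor
  · intro hH
    set T : Set SL(2, ℝ) := {H | ∃ X, InCone X ∧ 0 ≤ coord M X ∧ NonexpandingEigen H X} with hT
    have neg : ∀ A ∈ T, -A ∈ T := by
      rintro A ⟨X, hX, h0, μ, hμ, e⟩
      exact ⟨X, hX, h0, μ, hμ, by rw [act_neg, e]⟩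
    have sat : ((↑) : SL(2, ℝ) → G₀) ⁻¹' (((↑) : SL(2, ℝ) → G₀) '' T) = T := by
      refine Subset.antisymm ?_ (subset_preimage_image _ _)
      rintro A ⟨B, hB, e⟩
      rcases eq_or_eq_neg_of_coe_eq e with rfl | rfl
      · exact hB
      · exact neg B hB
    have hcl : IsClosed (((↑) : SL(2, ℝ) → G₀) '' T) := by
      have hq : IsQuotientMap ((↑) : SL(2, ℝ) → G₀) := isQuotientMap_quot_mk
      rw [← hq.isClosed_preimage, sat]
      exact isClosed_nonexpanding M
    have hsub : rightHalfSpace S ⊆ ((↑) : SL(2, ℝ) → G₀) '' T := by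
      intro h
      obtain ⟨A, rfl⟩ := QuotientGroup.mk_surjective h
      rintro ⟨-, p, ⟨hp, h0⟩, hn⟩
      exact ⟨A, ⟨sig p, inCone_sig p, h0.le, (isNonattractingFixedPoint_iff A hp).mp hn⟩, rfl⟩
    have := closure_minimal hsub hcl hH
    rw [← mem_preimage, sat] at this
    exact this
  · rintro ⟨X, hX, h0, hn⟩
    -- The identity is excluded from the open half-space, and its conjugates are trivial. It is
    -- approached instead by `push M s` with `s < 0`, whose repelling point is the positive ideal
    -- point `act M (sq (1, 1))`.
    by_cases h1 : (H : G₀) = 1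
    · rw [h1]
      have hcoord : ∀ s : ℝ, 0 < coord M (act M (sq (1, 1))) := fun s => by
        rw [coord_act]; simp [sq]
      have hcone : InCone (act M (sq (1, 1))) := (inCone_sq (by simp)).act M
      have eig : ∀ s : ℝ, s ≤ 0 → NonexpandingEigen (push M s) (act M (sq (1, 1))) := by
        intro s hs
        refine ⟨Real.exp s ^ 2, ?_, ?_⟩
        · exact pow_le_one₀ (Real.exp_pos s).le (Real.exp_le_one_iff.mpr hs)
        · exact act_push M s
      have lim : Tendsto (fun s : ℝ => ((push M s : SL(2, ℝ)) : G₀)) (𝓝[<] 0) (𝓝 1) := by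
        have := ((continuous_coe_PSL.comp (continuous_push M)).tendsto 0).mono_left
          (nhdsWithin_le_nhds (s := Iio 0))
        simpa [push_zero, Function.comp_def] using this
      refine mem_closure_of_tendsto lim ?_
      filter_upwards [self_mem_nhdsWithin] with s hs
      have hs : s < 0 := hs
      refine mem_rightHalfSpace hcone (hcoord s) (eig s hs.le) fun e => ?_
      have e1 : push M s = 1 ∨ push M s = -1 := eq_or_eq_neg_of_coe_eq e.symm
      have e2 : act (push M s) (act M (sq (1, 1))) = act M (sq (1, 1)) := by
        rcases e1 with e1 | e1 <;> simp [e1, act_neg, act_one]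
      have e4 := act_push M s
      rw [e2] at e4
      have e5 := congrArg (coord M) e4
      rw [coord_smul, coord_act] at e5
      simp [sq] at e5
      have := Real.exp_lt_one_iff.mpr hs
      have := Real.exp_pos s
      nlinarith
    · have lim : Tendsto (fun s : ℝ => ((push M s * H * (push M s)⁻¹ : SL(2, ℝ)) : G₀)) (𝓝[>] 0)
          (𝓝 (H : G₀)) := by
        have c : Continuous fun s : ℝ => push M s * H * (push M s)⁻¹ :=
          ((continuous_push M).mul continuous_const).mul (continuous_push M).inv
        have := ((continuous_coe_PSL.comp c).tendsto 0).mono_left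
          (nhdsWithin_le_nhds (s := Ioi 0))
        simpa [push_zero, Function.comp_def] using this
      refine mem_closure_of_tendsto lim ?_
      filter_upwards [self_mem_nhdsWithin] with s hs
      refine mem_rightHalfSpace (hX.act (push M s)) (coord_push_pos hX h0 hs) ?_ ?_
      · obtain ⟨μ, hμ, e⟩ := hn
        exact ⟨μ, hμ, by rw [act_mul, act_mul, act_inv_act, e, act_smul]⟩
      · intro e
        apply h1
        have e : ((push M s : SL(2, ℝ)) : G₀) * (H : G₀) * ((push M s : SL(2, ℝ)) : G₀)⁻¹ = 1 := e
        rwa [conj_eq_one_iff] at e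

/-! ### Uniform contraction between the two lines -/

lemma cosh_dist_smul (G G' : SL(2, ℝ)) (x x' : ℍ) :
    Real.cosh (dist ((G : G₀) • x) ((G' : G₀) • x')) =
      bil (act G (pt x)) (act G' (pt x')) / 2 := by
  change Real.cosh (dist (G • x) (G' • x')) = _
  rw [cosh_dist_eq, pt_smul, pt_smul]

/-- As `c ≤ c⁻¹`, one has `c cosh B ≤ cosh (B + log c)`. The bound `1 ≤ cosh A` gives `c⁻¹ ≤ cosh
B`, hence `0 ≤ B + log c`, and `cosh` can be inverted. -/
lemma sub_le_log_of_cosh_le {A B c : ℝ} (hA : 0 ≤ A) (hB : 0 ≤ B) (hc : 0 < c) (hc1 : c < 1)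
    (h : Real.cosh A ≤ c * Real.cosh B) : A - B ≤ Real.log c := by
  have hcosh : ∀ x, Real.cosh (x + Real.log c) = (Real.exp x * c + Real.exp (-x) * c⁻¹) / 2 := by
    intro x
    rw [Real.cosh_eq, neg_add, Real.exp_add, Real.exp_add, Real.exp_neg (Real.log c),
      Real.exp_log hc]
  have hic : 1 ≤ c⁻¹ := one_le_inv₀ hc |>.mpr hc1.le
  have h1 : Real.cosh A ≤ Real.cosh (B + Real.log c) := by
    refine h.trans ?_
    rw [hcosh, Real.cosh_eq]
    have := mul_le_mul_of_nonneg_left (hc1.le.trans hic) (Real.exp_pos (-B)).le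
    linarith
  have h2 : -Real.log c ≤ B := by
    have h3 : Real.cosh (Real.log c) ≤ Real.cosh B := by
      have h4 := hcosh 0
      rw [zero_add, Real.exp_zero, neg_zero, Real.exp_zero, one_mul, one_mul] at h4
      have h5 : c⁻¹ ≤ Real.cosh B := by
        rw [inv_le_iff_one_le_mul₀ hc, mul_comm]
        exact (Real.one_le_cosh A).trans h
      rw [h4]
      linarith
    rw [Real.cosh_le_cosh, abs_of_nonneg hB, abs_of_neg (Real.log_neg hc hc1)] at h3
    exact h3
  rw [Real.cosh_le_cosh, abs_of_nonneg hA, abs_of_nonneg (by linarith)] at h1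
  linarith

lemma PairingsDecrease.exists_const {G G' M M' : SL(2, ℝ)} (h : PairingsDecrease G G' M M') :
    ∃ c : ℝ, 0 < c ∧ c < 1 ∧ ∀ i j : Fin 2,
      det2 (col (G * M) i) (col (G' * M') j) ^ 2 ≤ c * det2 (col M i) (col M' j) ^ 2 := by
  set r : Fin 2 → Fin 2 → ℝ := fun i j =>
    det2 (col (G * M) i) (col (G' * M') j) ^ 2 / det2 (col M i) (col M' j) ^ 2 with hr
  have pos : ∀ i j : Fin 2, 0 < det2 (col M i) (col M' j) ^ 2 := fun i j =>
    (sq_nonneg _).trans_lt (h i j)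
  have r1 : ∀ i j, r i j < 1 := fun i j => (div_lt_one (pos i j)).mpr (h i j)
  -- All four ratios may be zero; the `1 / 2` keeps the constant positive, so that its logarithm is
  -- meaningful.
  refine ⟨max (1 / 2) (max (max (r 0 0) (r 0 1)) (max (r 1 0) (r 1 1))), by positivity,
    max_lt (by norm_num) (max_lt (max_lt (r1 0 0) (r1 0 1)) (max_lt (r1 1 0) (r1 1 1))),
    fun i j => ?_⟩
  rw [← div_le_iff₀ (pos i j)]
  change r i j ≤ _
  fin_cases i <;> fin_cases j <;> simp

lemma IsFrame.uniformlyCloser {G G' M M' : SL(2, ℝ)} {l l' : Set ℍ} (hM : IsFrame M l)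
    (hM' : IsFrame M' l') (h : PairingsDecrease G G' M M') :
    UniformlyCloser (G : G₀) (G' : G₀) l l' := by
  obtain ⟨c, hc, hc1, hf⟩ := h.exists_const
  refine ⟨-Real.log c, neg_pos.mpr (Real.log_neg hc hc1), fun x hx x' hx' => ?_⟩
  rw [neg_neg]
  refine sub_le_log_of_cosh_le dist_nonneg dist_nonneg hc hc1 ?_
  rw [cosh_dist_smul, cosh_dist_eq, ← mul_div_assoc]
  refine div_le_div_of_nonneg_right ?_ zero_le_two
  have h0 : (act M⁻¹ (pt x)).2.1 = 0 := (hM x).mp hx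
  have h0' : (act M'⁻¹ (pt x')).2.1 = 0 := (hM' x').mp hx'
  obtain ⟨p, q, -, -⟩ := (inCone_pt x).act M⁻¹
  obtain ⟨p', q', -, -⟩ := (inCone_pt x').act M'⁻¹
  have e := act_act_inv M (pt x)
  have e' := act_act_inv M' (pt x')
  generalize act M⁻¹ (pt x) = Y at *
  generalize act M'⁻¹ (pt x') = Y' at *
  rw [← e, ← e', ← act_mul, ← act_mul, bil_act_act, bil_act_act, h0, h0']
  have a00 := mul_le_mul_of_nonneg_left (hf 0 0) (mul_nonneg p p')
  have a01 := mul_le_mul_of_nonneg_left (hf 0 1) (mul_nonneg p q')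
  have a10 := mul_le_mul_of_nonneg_left (hf 1 0) (mul_nonneg q p')
  have a11 := mul_le_mul_of_nonneg_left (hf 1 1) (mul_nonneg q q')
  simp only [mul_zero, zero_mul, add_zero]
  linarith

/-- The point of the line of `M` with parameter `s`. -/
lemma IsFrame.exists_point {M : SL(2, ℝ)} {l : Set ℍ} (hM : IsFrame M l) {s : ℝ} (hs : 0 < s) :
    ∃ x ∈ l, pt x = act M (s, 0, s⁻¹) := by
  have hq : qdet ((s, 0, s⁻¹) : Form) = 1 := by simp [qdet, hs.ne']
  have hc : InCone (s, 0, s⁻¹) :=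
    ⟨hs.le, (inv_pos.mpr hs).le, by rw [hq]; exact zero_le_one, fun e => hs.ne' (by
      simpa using congrArg Prod.fst e)⟩
  obtain ⟨x, hx⟩ := exists_pt (hc.act M) (by rw [qdet_act, hq])
  exact ⟨x, (hM x).mpr (by rw [hx, coord_act]), hx⟩

/-- Let both points run to the endpoints given by the first columns and compare the leading terms of
the two hyperbolic cosines. The other pairs of endpoints follow by quarter turns. -/
lemma UniformlyCloser.pairing_lt {G G' M M' : SL(2, ℝ)} {l l' : Set ℍ}
    (h : UniformlyCloser (G : G₀) (G' : G₀) l l') (hM : IsFrame M l) (hM' : IsFrame M' l') :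
    det2 (col (G * M) 0) (col (G' * M') 0) ^ 2 < det2 (col M 0) (col M' 0) ^ 2 := by
  obtain ⟨K, hK, h⟩ := h
  have hdet := det_pairing M M'
  have key : ∀ s t : ℝ, 0 < s → 0 < t → ∃ A B : ℝ, 0 ≤ A ∧ A - B ≤ -K ∧
      2 * Real.cosh A = bil (act (G * M) (s, 0, s⁻¹)) (act (G' * M') (t, 0, t⁻¹)) ∧
      2 * Real.cosh B = bil (act M (s, 0, s⁻¹)) (act M' (t, 0, t⁻¹)) := by
    intro s t hs ht
    obtain ⟨x, hx, ex⟩ := hM.exists_point hs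
    obtain ⟨x', hx', ex'⟩ := hM'.exists_point ht
    refine ⟨_, _, dist_nonneg, h x hx x' hx', ?_, ?_⟩
    · rw [cosh_dist_smul, ex, ex', act_mul, act_mul]; ring
    · rw [cosh_dist_eq, ex, ex']; ring
  simp only [bil_act_act, mul_zero, zero_mul, add_zero] at key
  generalize det2 (col M 0) (col M' 0) = a at *
  generalize det2 (col M 0) (col M' 1) = b at *
  generalize det2 (col M 1) (col M' 0) = c at *
  generalize det2 (col M 1) (col M' 1) = d at *
  generalize det2 (col (G * M) 0) (col (G' * M') 0) = a' at *
  generalize det2 (col (G * M) 0) (col (G' * M') 1) = b' at *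
  generalize det2 (col (G * M) 1) (col (G' * M') 0) = c' at *
  generalize det2 (col (G * M) 1) (col (G' * M') 1) = d' at *
  -- With a shared endpoint, the parameters `N c²` and `N` give points of the two lines at distances
  -- tending to zero. But every distance `B` is at least `K`, since `0 ≤ A ≤ B - K`.
  have ha : a ≠ 0 := by
    rintro rfl
    have hbc : b * c = -1 := by linarith
    have hc : c ≠ 0 := by rintro rfl; simp at hbc
    have hch : 1 < Real.cosh K := Real.one_lt_cosh.mpr hK.ne'
    have lim : Tendsto (fun N : ℝ => d ^ 2 / c ^ 2 * (N⁻¹) ^ 2) atTop (𝓝 0) := by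
      have := (tendsto_inv_atTop_zero (𝕜 := ℝ)).pow 2
      simpa using this.const_mul (d ^ 2 / c ^ 2)
    obtain ⟨N, hN, hN0⟩ := ((lim.eventually_lt_const
      (show (0 : ℝ) < 2 * (Real.cosh K - 1) by linarith)).and (eventually_gt_atTop 0)).exists
    obtain ⟨A, B, hA, hAB, -, hB⟩ := key (N * c ^ 2) N (by positivity) hN0
    have e : N * c ^ 2 * N * 0 ^ 2 + N * c ^ 2 * N⁻¹ * b ^ 2 + (N * c ^ 2)⁻¹ * N * c ^ 2 +
        (N * c ^ 2)⁻¹ * N⁻¹ * d ^ 2 = (b * c) ^ 2 + 1 + d ^ 2 / c ^ 2 * (N⁻¹) ^ 2 := by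
      field_simp; ring
    rw [e, hbc] at hB
    have : Real.cosh K ≤ Real.cosh B := by
      rw [Real.cosh_le_cosh, abs_of_pos hK, abs_of_nonneg (by linarith)]; linarith
    linarith
  have hEK : Real.exp (-K) < 1 := Real.exp_lt_one_iff.mpr (by linarith)
  have hEK0 := Real.exp_pos (-K)
  suffices hle : a' ^ 2 ≤ Real.exp (-K) * a ^ 2 by
    have : 0 < a ^ 2 := by positivity
    nlinarith
  -- With both parameters equal to `T`, the pairings of the first columns have weight `T²` and all
  -- other terms stay bounded. Failure of the inequality is contradicted by a large `T`.
  by_contra! hlt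
  set C := Real.exp (-K) * (b ^ 2 + c ^ 2 + d ^ 2) + 1 with hC
  obtain ⟨T, hT, hT1⟩ := (((tendsto_id (α := ℝ) (x := atTop)).const_mul_atTop
    (sub_pos.mpr hlt)).eventually_gt_atTop C |>.and (eventually_ge_atTop 1)).exists
  simp only [id] at hT
  obtain ⟨A, B, hA, hAB, eA, eB⟩ := key T T (by linarith) (by linarith)
  have hT0 : 0 < T := by linarith
  have hBK : K ≤ B := by linarith
  have h1 : 2 * Real.cosh A ≤ Real.exp (-K) * (2 * Real.cosh B) + 1 := by
    have h2 : Real.cosh A ≤ Real.cosh (B - K) := by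
      rw [Real.cosh_le_cosh, abs_of_nonneg hA, abs_of_nonneg (by linarith)]; linarith
    have h3 : 2 * Real.cosh (B - K) = Real.exp (-K) * Real.exp B + Real.exp (-(B - K)) := by
      rw [Real.cosh_eq, ← Real.exp_add]; ring_nf
    have h4 : Real.exp (-(B - K)) ≤ 1 := Real.exp_le_one_iff.mpr (by linarith)
    have h5 : Real.exp B ≤ 2 * Real.cosh B := by
      rw [Real.cosh_eq]; linarith [Real.exp_pos (-B)]
    have := mul_le_mul_of_nonneg_left h5 hEK0.le
    linarith
  rw [eA, eB] at h1
  have hTi : T * T⁻¹ = 1 := mul_inv_cancel₀ hT0.ne'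
  have hTi' : T⁻¹ * T = 1 := inv_mul_cancel₀ hT0.ne'
  rw [hTi, hTi', one_mul, one_mul, one_mul, one_mul] at h1
  have hTii : T⁻¹ * T⁻¹ ≤ 1 := by
    have := inv_le_one_of_one_le₀ hT1
    exact mul_le_one₀ this (inv_pos.mpr hT0).le this
  have hTii0 : 0 ≤ T⁻¹ * T⁻¹ := by positivity
  have p1 : T⁻¹ * T⁻¹ * d ^ 2 ≤ d ^ 2 := by nlinarith [sq_nonneg d]
  have p2 : 0 ≤ T⁻¹ * T⁻¹ * d' ^ 2 := by positivity
  have p3 := mul_le_mul_of_nonneg_left p1 hEK0.le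
  have p4 : T * T * (a' ^ 2 - Real.exp (-K) * a ^ 2) ≤ C := by
    rw [hC]; nlinarith [sq_nonneg b', sq_nonneg c']
  have p5 : (a' ^ 2 - Real.exp (-K) * a ^ 2) * T ≤ T * T * (a' ^ 2 - Real.exp (-K) * a ^ 2) := by
    have : 0 ≤ (a' ^ 2 - Real.exp (-K) * a ^ 2) * T * (T - 1) :=
      mul_nonneg (mul_nonneg (by linarith) hT0.le) (by linarith)
    linarith
  linarith

lemma UniformlyCloser.pairingsDecrease {G G' M M' : SL(2, ℝ)} {l l' : Set ℍ}
    (h : UniformlyCloser (G : G₀) (G' : G₀) l l') (hM : IsFrame M l) (hM' : IsFrame M' l') :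
    PairingsDecrease G G' M M' := by
  have h00 := h.pairing_lt hM hM'
  have h01 := h.pairing_lt hM hM'.mul_quarterTurn
  have h10 := h.pairing_lt hM.mul_quarterTurn hM'
  have h11 := h.pairing_lt hM.mul_quarterTurn hM'.mul_quarterTurn
  simp only [← mul_assoc, col_mul_quarterTurn_zero] at h01 h10 h11
  intro i j
  fin_cases i <;> fin_cases j <;> assumption

/-! ### The extended difference at ideal points -/

lemma exp_le_two_mul_cosh (x : ℝ) : Real.exp x ≤ 2 * Real.cosh x := by
  rw [Real.cosh_eq]; linarith [Real.exp_pos (-x)]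

lemma cosh_le_exp {x : ℝ} (hx : 0 ≤ x) : Real.cosh x ≤ Real.exp x := by
  rw [Real.cosh_eq]
  have := Real.exp_le_exp.mpr (show -x ≤ x by linarith)
  linarith

lemma tendsto_exp_div_cosh : Tendsto (fun x : ℝ => Real.exp x / Real.cosh x) atTop (𝓝 2) := by
  have h1 : Tendsto (fun x : ℝ => 2 / (1 + Real.exp (-x) ^ 2)) atTop (𝓝 (2 / (1 + 0 ^ 2))) :=
    (tendsto_const_nhds).div (tendsto_const_nhds.add (Real.tendsto_exp_neg_atTop_nhds_zero.pow 2))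
      (by norm_num)
  have h2 : (2 : ℝ) / (1 + 0 ^ 2) = 2 := by norm_num
  rw [h2] at h1
  refine h1.congr fun x => ?_
  have := Real.exp_pos x
  rw [Real.cosh_eq, Real.exp_neg]
  field_simp

/-- Exponentials of differences have the same limit as ratios of hyperbolic cosines. -/
lemma tendsto_exp_sub {ι : Type*} {F : Filter ι} {A B : ι → ℝ} {ρ : ℝ} (hA : ∀ i, 0 ≤ A i)
    (hB : ∀ i, 0 ≤ B i) (hρ0 : 0 ≤ ρ) (hlim : Tendsto (fun i => Real.cosh (B i)) F atTop)
    (hρ : Tendsto (fun i => Real.cosh (A i) / Real.cosh (B i)) F (𝓝 ρ)) :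
    Tendsto (fun i => Real.exp (A i - B i)) F (𝓝 ρ) := by
  have aux : ∀ {D : ι → ℝ}, (∀ i, 0 ≤ D i) → Tendsto (fun i => Real.cosh (D i)) F atTop →
      Tendsto D F atTop := by
    intro D hD hc
    have := Real.tendsto_log_atTop.comp (tendsto_atTop_mono (fun i => cosh_le_exp (hD i)) hc)
    simpa [Function.comp_def] using this
  -- When `ρ = 0` the `A i` need not tend to infinity, so only a bound by twice the ratio is used.
  -- When `ρ > 0` both distances diverge and `exp` is asymptotic to `2 cosh`.
  rcases hρ0.eq_or_lt with h0 | h0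
  · rw [← h0] at hρ ⊢
    refine squeeze_zero (fun i => (Real.exp_pos _).le) (fun i => ?_)
      (by simpa using hρ.const_mul 2)
    rw [Real.exp_sub, ← mul_div_assoc]
    have := Real.cosh_pos (A i)
    exact div_le_div₀ (by positivity) (exp_le_two_mul_cosh _) (Real.cosh_pos _)
      (cosh_le_exp (hB i))
  · have hcA : Tendsto (fun i => Real.cosh (A i)) F atTop := by
      refine (hρ.pos_mul_atTop h0 hlim).congr fun i => ?_
      have := Real.cosh_pos (B i)
      field_simp
    have l1 := tendsto_exp_div_cosh.comp (aux hA hcA)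
    have l2 := tendsto_exp_div_cosh.comp (aux hB hlim)
    have l3 := (hρ.mul l1).div l2 two_ne_zero
    rw [mul_div_assoc, div_self two_ne_zero, mul_one] at l3
    refine l3.congr fun i => ?_
    have := Real.cosh_pos (A i)
    have := Real.cosh_pos (B i)
    have := Real.exp_pos (B i)
    simp only [Function.comp, Pi.div_apply]
    rw [Real.exp_sub]
    field_simp

lemma continuous_bil : Continuous fun q : Form × Form => bil q.1 q.2 := by
  unfold bil; fun_prop

lemma continuous_qdet : Continuous qdet := by
  unfold qdet; fun_prop

lemma continuous_act_right (g : SL(2, ℝ)) : Continuous (act g) :=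
  continuous_act.comp (Continuous.prodMk_right g)

lemma tendsto_bil {ι : Type*} {F : Filter ι} {f g : ι → Form} {X Y : Form}
    (hf : Tendsto f F (𝓝 X)) (hg : Tendsto g F (𝓝 Y)) :
    Tendsto (fun i => bil (f i) (g i)) F (𝓝 (bil X Y)) :=
  Tendsto.comp (g := fun q : Form × Form => bil q.1 q.2) (continuous_bil.tendsto (X, Y))
    (hf.prodMk_nhds hg)

lemma tendsto_act {ι : Type*} {F : Filter ι} {f : ι → Form} {X : Form} (G : SL(2, ℝ))
    (hf : Tendsto f F (𝓝 X)) : Tendsto (fun i => act G (f i)) F (𝓝 (act G X)) :=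
  Tendsto.comp (g := act G) ((continuous_act_right G).tendsto X) hf

/-- Near an ideal point `pt` is `sig` divided by a scalar `k` tending to zero. These scalars cancel
in the ratio of hyperbolic cosines, which tends to the ratio of `bil` values, while `cosh d` itself
diverges. The ratio may be zero, and `ENNReal.log` then gives the value `-∞`. -/
lemma hasExtendedDifference {ξ ξ' : OnePoint ℂ} (G G' : SL(2, ℝ)) (hq : qdet (sig ξ) = 0)
    (hq' : qdet (sig ξ') = 0) (h : 0 < bil (sig ξ) (sig ξ')) :
    HasExtendedDifference (G : G₀) (G' : G₀) ξ ξ' (ENNReal.log (ENNReal.ofReal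
      (bil (act G (sig ξ)) (act G' (sig ξ')) / bil (sig ξ) (sig ξ')))) := by
  unfold HasExtendedDifference
  set F := comap toSphere (𝓝 ξ) ×ˢ comap toSphere (𝓝 ξ') with hF
  have l1 : Tendsto (fun q : ℍ × ℍ => sig (toSphere q.1)) F (𝓝 (sig ξ)) :=
    (continuous_sig.tendsto ξ).comp ((tendsto_comap (f := toSphere)).comp tendsto_fst)
  have l2 : Tendsto (fun q : ℍ × ℍ => sig (toSphere q.2)) F (𝓝 (sig ξ')) :=
    (continuous_sig.tendsto ξ').comp ((tendsto_comap (f := toSphere)).comp tendsto_snd)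
  obtain ⟨k, hkpos, hsig⟩ : ∃ k : ℍ → ℝ, (∀ z, 0 < k z) ∧ ∀ z, sig (toSphere z) = k z • pt z :=
    ⟨fun z => z.im / (1 + Complex.normSq z),
      fun z => div_pos z.im_pos (one_add_normSq_pos z), sig_toSphere⟩
  have hksq : ∀ z, k z = √(qdet (sig (toSphere z))) := fun z => by
    rw [hsig, qdet_smul, qdet_pt, mul_one, Real.sqrt_sq (hkpos z).le]
  have k1 : Tendsto (fun q : ℍ × ℍ => k q.1) F (𝓝 0) := by
    have := ((continuous_qdet.tendsto _).comp l1).sqrt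
    rw [hq, Real.sqrt_zero] at this
    exact this.congr fun q => (hksq q.1).symm
  have k2 : Tendsto (fun q : ℍ × ℍ => k q.2) F (𝓝 0) := by
    have := ((continuous_qdet.tendsto _).comp l2).sqrt
    rw [hq', Real.sqrt_zero] at this
    exact this.congr fun q => (hksq q.2).symm
  have lb : Tendsto (fun q : ℍ × ℍ => bil (sig (toSphere q.1)) (sig (toSphere q.2))) F
      (𝓝 (bil (sig ξ) (sig ξ'))) :=
    tendsto_bil l1 l2
  have lb' : Tendsto (fun q : ℍ × ℍ => bil (act G (sig (toSphere q.1)))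
      (act G' (sig (toSphere q.2)))) F (𝓝 (bil (act G (sig ξ)) (act G' (sig ξ')))) :=
    tendsto_bil (tendsto_act G l1) (tendsto_act G' l2)
  have hcB : Tendsto (fun q : ℍ × ℍ => Real.cosh (dist q.1 q.2)) F atTop := by
    have l3 : Tendsto (fun q : ℍ × ℍ => (2 * (k q.1 * k q.2))⁻¹) F atTop := by
      refine Tendsto.inv_tendsto_nhdsGT_zero (tendsto_nhdsWithin_iff.mpr ⟨?_, ?_⟩)
      · simpa using (k1.mul k2).const_mul 2
      · exact Eventually.of_forall fun q => by
          have := hkpos q.1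
          have := hkpos q.2
          simp only [mem_Ioi]; positivity
    refine (lb.pos_mul_atTop h l3).congr fun q => ?_
    have := hkpos q.1
    have := hkpos q.2
    rw [cosh_dist_eq, hsig, hsig, bil_smul_left, bil_smul_right]
    field_simp
  have hratio : Tendsto (fun q : ℍ × ℍ => Real.cosh (dist ((G : G₀) • q.1) ((G' : G₀) • q.2)) /
      Real.cosh (dist q.1 q.2)) F
      (𝓝 (bil (act G (sig ξ)) (act G' (sig ξ')) / bil (sig ξ) (sig ξ'))) := by
    refine (lb'.div lb h.ne').congr fun q => ?_
    have := hkpos q.1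
    have := hkpos q.2
    simp only [Pi.div_apply]
    rw [cosh_dist_smul, cosh_dist_eq, hsig, hsig, act_smul, act_smul, bil_smul_left, bil_smul_left,
      bil_smul_right, bil_smul_right]
    field_simp
  have hexp := tendsto_exp_sub (fun q => dist_nonneg) (fun q => dist_nonneg)
    (div_nonneg (bil_nonneg ((inCone_sig ξ).act G) ((inCone_sig ξ').act G')) h.le) hcB hratio
  have := (ENNReal.continuous_log.tendsto _).comp ((ENNReal.continuous_ofReal.tendsto _).comp hexp)
  refine this.congr fun q => ?_
  simp only [Function.comp]
  rw [ENNReal.log_ofReal_of_pos (Real.exp_pos _), Real.log_exp]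

lemma neBot_comap_toSphere {p : OnePoint ℂ} (hp : p ∈ closedPlane) :
    (comap toSphere (𝓝 p)).NeBot := by
  rw [comap_neBot_iff]
  intro t ht
  obtain ⟨_, h, z, rfl⟩ := mem_closure_iff_nhds.mp hp t ht
  exact ⟨z, h⟩

/-! ### Equivalence of the conditions -/

lemma disjoint_smul_iff (G G' : SL(2, ℝ)) (A B : Set G₀) :
    Disjoint ((G : G₀) • A) ((G' : G₀) • B) ↔
      ∀ γ : SL(2, ℝ), ¬ (((G⁻¹ * γ : SL(2, ℝ)) : G₀) ∈ A ∧ ((G'⁻¹ * γ : SL(2, ℝ)) : G₀) ∈ B) := by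
  rw [Set.disjoint_left]
  constructor
  · rintro h γ ⟨h1, h2⟩
    exact h (mem_smul_set_iff_inv_smul_mem.mpr h1 : (γ : G₀) ∈ _)
      (mem_smul_set_iff_inv_smul_mem.mpr h2)
  · intro h x h1 h2
    obtain ⟨γ, rfl⟩ := QuotientGroup.mk_surjective x
    exact h γ ⟨mem_smul_set_iff_inv_smul_mem.mp h1, mem_smul_set_iff_inv_smul_mem.mp h2⟩

lemma inCone_combination {v w : ℝ × ℝ} (hv : v ≠ 0) (hw : w ≠ 0) {a b : ℝ} (ha : 0 ≤ a)
    (hb : 0 ≤ b) (h : 0 < a ∨ 0 < b) : InCone (a • sq v + b • sq w) := by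
  have tv := (inCone_sq hv).trace_pos
  have tw := (inCone_sq hw).trace_pos
  have e : qdet (a • sq v + b • sq w) = a * b * det2 v w ^ 2 := by
    simp only [qdet, sq, det2, Prod.fst_add, Prod.snd_add, Prod.smul_fst, Prod.smul_snd,
      smul_eq_mul]
    ring
  refine ⟨add_nonneg (mul_nonneg ha (sq_nonneg _)) (mul_nonneg hb (sq_nonneg _)),
    add_nonneg (mul_nonneg ha (sq_nonneg _)) (mul_nonneg hb (sq_nonneg _)),
    by rw [e]; positivity, fun h0 => ?_⟩
  have h1 : a * ((sq v).1 + (sq v).2.2) + b * ((sq w).1 + (sq w).2.2) = 0 := by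
    have h1 := congrArg Prod.fst h0
    have h2 := congrArg (fun X : Form => X.2.2) h0
    simp only [Prod.fst_add, Prod.snd_add, Prod.smul_fst, Prod.smul_snd, smul_eq_mul,
      Prod.fst_zero, Prod.snd_zero] at h1 h2
    linarith
  have h2 := mul_nonneg ha tv.le
  have h3 := mul_nonneg hb tw.le
  rcases h with h | h
  · have := mul_pos h tv; linarith
  · have := mul_pos h tw; linarith

lemma IsFrame.crookedPlanesDisjoint {G G' M M' : SL(2, ℝ)} {l l' : Set ℍ} (hM : IsFrame M l)
    (hM' : IsFrame M' l') (h : PairingsDecrease G G' M M') :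
    CrookedPlanesDisjoint (G : G₀) (G' : G₀) l l' := by
  rw [CrookedPlanesDisjoint, disjoint_smul_iff]
  rintro γ ⟨h1, h2⟩
  obtain ⟨X, hX, h0, hn⟩ := (hM.mem_rightCrookedPlane_iff _).mp h1
  obtain ⟨X', hX', h0', hn'⟩ := (hM'.mem_rightCrookedPlane_iff _).mp h2
  have h3 := h.bil_lt (hX.act M⁻¹) (hX'.act M'⁻¹) h0 h0'
  rw [act_mul, act_mul, act_act_inv, act_act_inv] at h3
  exact absurd (hn.bil_le hn' hX hX') (not_le.mpr h3)

/-- A pair of endpoints whose pairing does not decrease yields a common element. If the pairing is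
zero, the endpoints coincide and the other column of `M'` completes the second line. -/
lemma CrookedPlanesDisjoint.pairingsDecrease {G G' M M' : SL(2, ℝ)} {l l' : Set ℍ}
    (h : CrookedPlanesDisjoint (G : G₀) (G' : G₀) l l') (hM : IsFrame M l) (hM' : IsFrame M' l') :
    PairingsDecrease G G' M M' := by
  rw [CrookedPlanesDisjoint, disjoint_smul_iff] at h
  intro i j
  by_contra! hle
  rw [col_mul, col_mul] at hle
  by_cases h0 : det2 (col M i) (col M' j) = 0
  · have hj : ∃ k, det2 (col M' j) (col M' k) ≠ 0 := by
      have hd := det2_col M'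
      fin_cases j
      · exact ⟨1, by simp [hd]⟩
      · refine ⟨0, ?_⟩
        have : det2 (col M' 1) (col M' 0) = -det2 (col M' 0) (col M' 1) := by
          simp only [det2]; ring
        simp [this, hd]
    obtain ⟨k, hk⟩ := hj
    obtain ⟨γ, a, b, ha, hb, hab, hn, hn'⟩ := exists_common_of_det2_eq_zero (G := G) (G' := G')
      (col_ne_zero M i) (col_ne_zero M' j) h0 hk
    refine h γ ⟨(hM.mem_rightCrookedPlane_iff _).mpr ⟨_, inCone_sq (col_ne_zero M i),
      coord_sq_col M i, hn⟩, (hM'.mem_rightCrookedPlane_iff _).mpr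
      ⟨_, inCone_combination (col_ne_zero M' j) (col_ne_zero M' k) ha hb hab, ?_, hn'⟩⟩
    rw [coord_add, coord_smul, coord_smul, coord_sq_col, coord_sq_col]; ring
  · obtain ⟨γ, hn, hn'⟩ := exists_common_of_le h0 hle
    exact h γ ⟨(hM.mem_rightCrookedPlane_iff _).mpr ⟨_, inCone_sq (col_ne_zero M i),
      coord_sq_col M i, hn⟩, (hM'.mem_rightCrookedPlane_iff _).mpr
      ⟨_, inCone_sq (col_ne_zero M' j), coord_sq_col M' j, hn'⟩⟩

lemma ratio_eq (G G' M M' : SL(2, ℝ)) (i j : Fin 2) {X X' : Form} {c c' : ℝ} (hc : c ≠ 0)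
    (hc' : c' ≠ 0) (hX : X = c • sq (col M i)) (hX' : X' = c' • sq (col M' j)) :
    bil (act G X) (act G' X') / bil X X' =
      det2 (col (G * M) i) (col (G' * M') j) ^ 2 / det2 (col M i) (col M' j) ^ 2 := by
  rw [hX, hX', act_smul, act_smul, act_sq, act_sq, bil_smul_left, bil_smul_right, bil_smul_left,
    bil_smul_right, bil_sq, bil_sq, col_mul, col_mul, ← mul_assoc, ← mul_assoc,
    mul_div_mul_left _ _ (mul_ne_zero hc hc')]

lemma IsFrame.closerAtEndpoints {G G' M M' : SL(2, ℝ)} {l l' : Set ℍ} (hM : IsFrame M l)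
    (hM' : IsFrame M' l') (h : PairingsDecrease G G' M M') :
    CloserAtEndpoints (G : G₀) (G' : G₀) l l' := by
  intro ξ hξ ξ' hξ'
  obtain ⟨hp, i, c, hc, e⟩ := hM.mem_endpoints_iff.mp hξ
  obtain ⟨hp', j, c', hc', e'⟩ := hM'.mem_endpoints_iff.mp hξ'
  have hpos : 0 < det2 (col M i) (col M' j) ^ 2 := (sq_nonneg _).trans_lt (h i j)
  have hb : 0 < bil (sig ξ) (sig ξ') := by
    rw [e, e', bil_smul_left, bil_smul_right, bil_sq]; positivity
  have hq : qdet (sig ξ) = 0 := by rw [e, qdet_smul, qdet_sq, mul_zero]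
  have hq' : qdet (sig ξ') = 0 := by rw [e', qdet_smul, qdet_sq, mul_zero]
  refine ⟨?_, _, hasExtendedDifference G G' hq hq' hb, ?_⟩
  · rintro rfl
    rw [bil_self, hq] at hb
    simp at hb
  · rw [ENNReal.log_lt_zero_iff, ENNReal.ofReal_lt_one,
      ratio_eq G G' M M' i j hc.ne' hc'.ne' e e', div_lt_one hpos]
    exact h i j

lemma CloserAtEndpoints.pairingsDecrease {G G' M M' : SL(2, ℝ)} {l l' : Set ℍ}
    (h : CloserAtEndpoints (G : G₀) (G' : G₀) l l') (hM : IsFrame M l) (hM' : IsFrame M' l') :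
    PairingsDecrease G G' M M' := by
  intro i j
  have aux : ∀ (M : SL(2, ℝ)) (i : Fin 2),
      ∃ p ∈ closedPlane, ∃ c : ℝ, 0 < c ∧ sig p = c • sq (col M i) := by
    intro M i
    obtain ⟨p, hp, c, hc, e⟩ := exists_sig (inCone_sq (col_ne_zero M i))
    exact ⟨p, hp, c⁻¹, inv_pos.mpr hc, by rw [e, smul_smul, inv_mul_cancel₀ hc.ne', one_smul]⟩
  obtain ⟨ξ, hp, c, hc, e⟩ := aux M i
  obtain ⟨ξ', hp', c', hc', e'⟩ := aux M' j
  obtain ⟨hne, L, hL, hL0⟩ := h ξ (hM.mem_endpoints_iff.mpr ⟨hp, i, c, hc, e⟩) ξ'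
    (hM'.mem_endpoints_iff.mpr ⟨hp', j, c', hc', e'⟩)
  have hdet : det2 (col M i) (col M' j) ≠ 0 := by
    intro h0
    obtain ⟨k, hk⟩ := exists_smul_of_det2_eq_zero (col_ne_zero M i) h0
    apply hne
    have e1 : sig ξ' = (c' * k ^ 2 * c⁻¹) • sig ξ := by
      rw [e, e', hk, sq_smul, smul_smul, smul_smul]
      congr 1
      field_simp
    have t := sig_trace ξ
    have t' := sig_trace ξ'
    have e2 : c' * k ^ 2 * c⁻¹ = 1 := by
      have h1 := congrArg (fun X : Form => X.1 + X.2.2) e1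
      simp only [Prod.smul_fst, Prod.smul_snd, smul_eq_mul, ← mul_add, t, t', mul_one] at h1
      exact h1.symm
    rw [e2, one_smul] at e1
    exact sig_injOn hp hp' e1.symm
  have hpos : 0 < det2 (col M i) (col M' j) ^ 2 := by positivity
  have hb : 0 < bil (sig ξ) (sig ξ') := by
    rw [e, e', bil_smul_left, bil_smul_right, bil_sq]; positivity
  have hlim := hasExtendedDifference G G' (by rw [e, qdet_smul, qdet_sq, mul_zero])
    (by rw [e', qdet_smul, qdet_sq, mul_zero]) hb
  have := neBot_comap_toSphere hp
  have := neBot_comap_toSphere hp'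
  have hLeq := tendsto_nhds_unique hL hlim
  rw [hLeq, ENNReal.log_lt_zero_iff, ENNReal.ofReal_lt_one,
    ratio_eq G G' M M' i j hc.ne' hc'.ne' e e', div_lt_one hpos] at hL0
  exact hL0

/-- At a common point `X` strict decrease would give `bil (G X) (G' X) < 2 det X`, contrary to the
reverse Cauchy-Schwarz inequality. Ideal points are included, with `det X = 0`. -/
lemma PairingsDecrease.disjoint_clo {G G' M M' : SL(2, ℝ)} {l l' : Set ℍ}
    (h : PairingsDecrease G G' M M') (hM : IsFrame M l) (hM' : IsFrame M' l') :
    Disjoint (clo l) (clo l') := by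
  rw [Set.disjoint_left]
  intro p hp hp'
  have h0 := (hM.mem_clo_iff.mp hp).2
  have h0' := (hM'.mem_clo_iff.mp hp').2
  have hX := inCone_sig p
  have h1 := h.bil_lt (hX.act M⁻¹) (hX.act M'⁻¹) h0 h0'
  rw [act_mul, act_mul, act_act_inv, act_act_inv, bil_self] at h1
  have h2 := two_qdet_le_bil (hX.act G) (hX.act G') (by rw [qdet_act, qdet_act])
  rw [qdet_act] at h2
  linarith

/-! ### Half-spaces -/

lemma SameSign.disjoint_sides {M M' : SL(2, ℝ)} (h : SameSign M M') :
    Disjoint {p | p ∈ closedPlane ∧ 0 < coord M (sig p)}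
      {p | p ∈ closedPlane ∧ 0 < coord M' (sig p)} := by
  rw [Set.disjoint_left]
  rintro p ⟨-, h1⟩ ⟨-, h2⟩
  have h3 := h.coord_neg ((inCone_sig p).act M'⁻¹) h2.le
  rw [act_act_inv] at h3
  exact absurd h1 (not_lt.mpr h3.le)

lemma col_add_smul_col (M : SL(2, ℝ)) (s : ℝ) :
    sq (col M 0 + s • col M 1) = act M (sq (1, s)) := by
  rw [act_sq]
  congr 1
  simp only [mulv, col]
  ext <;> simp [mul_comm]

lemma col_add_smul_col_ne_zero (M : SL(2, ℝ)) (s : ℝ) : col M 0 + s • col M 1 ≠ 0 := by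
  intro h
  have := congrArg sq h
  rw [col_add_smul_col] at this
  have h1 := ((inCone_sq (v := (1, s)) (by simp)).act M).2.2.2
  exact h1 (by rw [this]; simp [sq])

lemma coord_col_add_smul_col (M : SL(2, ℝ)) (s : ℝ) :
    coord M (sq (col M 0 + s • col M 1)) = s := by
  rw [col_add_smul_col, coord_act]; simp [sq]

lemma PairingsDecrease.ne_zero {G G' M M' : SL(2, ℝ)} (h : PairingsDecrease G G' M M')
    (i j : Fin 2) : det2 (col M i) (col M' j) ≠ 0 := fun h0 => by
  have := h i j
  rw [h0] at this
  nlinarith [sq_nonneg (det2 (col (G * M) i) (col (G' * M') j))]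

/-- If the signs differ, the open positive arcs at infinity share an ideal point, which lies on both
sides. -/
lemma PairingsDecrease.sameSign_of_disjoint {G G' M M' : SL(2, ℝ)}
    (h : PairingsDecrease G G' M M')
    (hd : Disjoint {p | p ∈ closedPlane ∧ 0 < coord M (sig p)}
      {p | p ∈ closedPlane ∧ 0 < coord M' (sig p)}) : SameSign M M' := by
  by_contra hs
  obtain ⟨s, t, hs0, ht0, h0⟩ := exists_common_vector h.ne_zero hs
  obtain ⟨k, hk⟩ := exists_smul_of_det2_eq_zero (col_add_smul_col_ne_zero M s) h0
  obtain ⟨p, hp, c, hc, e⟩ := exists_sig (inCone_sq (col_add_smul_col_ne_zero M s))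
  have hk0 : k ≠ 0 := by
    rintro rfl
    exact col_add_smul_col_ne_zero M' t (by rw [hk, zero_smul])
  have h1 : c * coord M (sig p) = s := by rw [← coord_smul, ← e, coord_col_add_smul_col]
  have h2 : (k ^ 2 * c) * coord M' (sig p) = t := by
    rw [← coord_smul, ← smul_smul, ← e, ← sq_smul, ← hk, coord_col_add_smul_col]
  have hkc : 0 < k ^ 2 * c := by positivity
  exact Set.disjoint_left.mp hd ⟨hp, pos_of_mul_pos_right (by rw [h1]; exact hs0) hc.le⟩
    ⟨hp, pos_of_mul_pos_right (by rw [h2]; exact ht0) hkc.le⟩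

lemma PairingsDecrease.disjoint_halfSpaces_iff {G G' M M' : SL(2, ℝ)}
    (h : PairingsDecrease G G' M M') :
    Disjoint ((G : G₀) • closure (rightHalfSpace {p | p ∈ closedPlane ∧ 0 < coord M (sig p)}))
      ((G' : G₀) • closure (rightHalfSpace {p | p ∈ closedPlane ∧ 0 < coord M' (sig p)})) ↔
      SameSign M M' := by
  rw [disjoint_smul_iff]
  simp only [mem_closure_rightHalfSpace_iff]
  constructor
  · intro hd
    by_contra hs
    obtain ⟨s, t, hs0, ht0, h0⟩ := exists_common_vector h.ne_zero hs
    have h1 : det2 (col M' 0 + t • col M' 1) (col M' 1) ≠ 0 := by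
      have := det2_col M'
      have e : det2 (col M' 0 + t • col M' 1) (col M' 1) = det2 (col M' 0) (col M' 1) := by
        simp only [det2, Prod.fst_add, Prod.snd_add, Prod.smul_fst, Prod.smul_snd, smul_eq_mul]
        ring
      rw [e, this]
      exact one_ne_zero
    -- The common ideal point plays the role of a shared endpoint, of the auxiliary line joining it
    -- to the second column of `M'`. That closed line stays on the closed positive side of `M'`.
    obtain ⟨γ, a, b, ha, hb, hab, hn, hn'⟩ := exists_common_of_det2_eq_zero (G := G) (G' := G')
      (col_add_smul_col_ne_zero M s) (col_add_smul_col_ne_zero M' t) h0 h1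
    refine hd γ ⟨⟨_, inCone_sq (col_add_smul_col_ne_zero M s), ?_, hn⟩,
      ⟨_, inCone_combination (col_add_smul_col_ne_zero M' t) (col_ne_zero M' 1) ha hb hab, ?_,
        hn'⟩⟩
    · rw [coord_col_add_smul_col]; exact hs0.le
    · rw [coord_add, coord_smul, coord_smul, coord_col_add_smul_col, coord_sq_col, mul_zero,
        add_zero]
      positivity
  · rintro hs γ ⟨⟨X, hX, h0, hn⟩, ⟨X', hX', h0', hn'⟩⟩
    have h3 := h.bil_lt_of_sameSign hs (hX.act M⁻¹) (hX'.act M'⁻¹) h0 h0'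
    rw [act_mul, act_mul, act_act_inv, act_act_inv] at h3
    exact absurd (hn.bil_le hn' hX hX') (not_le.mpr h3)

lemma IsFrame.crookedPlanesDisjoint_of_halfSpaces {G G' M M' : SL(2, ℝ)} {l l' : Set ℍ}
    (hM : IsFrame M l) (hM' : IsFrame M' l')
    (h : Disjoint
      ((G : G₀) • closure (rightHalfSpace {p | p ∈ closedPlane ∧ 0 < coord M (sig p)}))
      ((G' : G₀) • closure (rightHalfSpace {p | p ∈ closedPlane ∧ 0 < coord M' (sig p)}))) :
    CrookedPlanesDisjoint (G : G₀) (G' : G₀) l l' := by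
  rw [disjoint_smul_iff] at h
  rw [CrookedPlanesDisjoint, disjoint_smul_iff]
  rintro γ ⟨h1, h2⟩
  obtain ⟨X, hX, h0, hn⟩ := (hM.mem_rightCrookedPlane_iff _).mp h1
  obtain ⟨X', hX', h0', hn'⟩ := (hM'.mem_rightCrookedPlane_iff _).mp h2
  exact h γ ⟨(mem_closure_rightHalfSpace_iff M _).mpr ⟨X, hX, h0.ge, hn⟩,
    (mem_closure_rightHalfSpace_iff M' _).mpr ⟨X', hX', h0'.ge, hn'⟩⟩

end AdSCrooked


open AdSCrooked
theorem theorem3p2 (l l' : Set ℍ) (hl : IsGeodesicLine l) (hl' : IsGeodesicLine l')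
    (g g' : G₀) :
    List.TFAE [CrookedPlanesDisjoint g g' l l', UniformlyCloser g g' l l',
      CloserAtEndpoints g g' l l'] ∧
    (CrookedPlanesDisjoint g g' l l' → Disjoint (clo l) (clo l')) ∧
    (∀ S S' : Set (OnePoint ℂ), IsSide l S → IsSide l' S' →
      (Disjoint (g • closure (rightHalfSpace S)) (g' • closure (rightHalfSpace S')) ↔
        (CrookedPlanesDisjoint g g' l l' ∧ UniformlyCloser g g' l l' ∧
          CloserAtEndpoints g g' l l') ∧ Disjoint S S')) := by
  obtain ⟨G, rfl⟩ := QuotientGroup.mk_surjective g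
  obtain ⟨G', rfl⟩ := QuotientGroup.mk_surjective g'
  obtain ⟨M₀, h₀⟩ := exists_isFrame hl
  obtain ⟨M₀', h₀'⟩ := exists_isFrame hl'
  refine ⟨?_, fun h => (h.pairingsDecrease h₀ h₀').disjoint_clo h₀ h₀', ?_⟩
  · tfae_have 1 → 2 := fun h => h₀.uniformlyCloser h₀' (h.pairingsDecrease h₀ h₀')
    tfae_have 2 → 3 := fun h => h₀.closerAtEndpoints h₀' (h.pairingsDecrease h₀ h₀')
    tfae_have 3 → 1 := fun h => h₀.crookedPlanesDisjoint h₀' (h.pairingsDecrease h₀ h₀')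
    tfae_finish
  · intro S S' hS hS'
    -- The frames are rechosen so that the given sides are those of positive coordinate.
    obtain ⟨M, hM, rfl⟩ := h₀.exists_of_isSide hS
    obtain ⟨M', hM', rfl⟩ := h₀'.exists_of_isSide hS'
    constructor
    · intro hd
      have h1 := hM.crookedPlanesDisjoint_of_halfSpaces hM' hd
      have h2 := h1.pairingsDecrease hM hM'
      exact ⟨⟨h1, hM.uniformlyCloser hM' h2, hM.closerAtEndpoints hM' h2⟩,
        (h2.disjoint_halfSpaces_iff.mp hd).disjoint_sides⟩
    · rintro ⟨⟨h1, -, -⟩, hd⟩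
      have h2 := h1.pairingsDecrease hM hM'
      exact h2.disjoint_halfSpaces_iff.mpr (h2.sameSign_of_disjoint hd)
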